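/- Let $k\ge 2$, $0<\delta<1/k$ and $\delta\le\pi^*\le 1/k$. Let $\mathbb{M}^k_{\delta,\pi^*}$ be the collection of all Markov chains over $[k]=\{1,\dots,k\}$, with an arbitrary initial distribution and a transition matrix $M$ such that $M_{ij}\ge\delta$ for all $i,j\in[k]$, whose stationary distribution $\pi$ satisfies $\min_{i\in[k]}\pi_i=\pi^*$. An estimator $\hat M$ maps each sequence $x^n\in[k]^n$ to a transition matrix $\hat M_{x^n}$ over $[k]\times[k]$. For a sample $X^n=(X_1,\dots,X_n)$ of the chain, let $$r_i(M,\hat M)=\mathbb{E}_{X^n\sim(M)}\Big[\sum_{j\in[k]}\big(M_{ij}-\hat M_{X^n}(i,j)\big)^2\Big]$$ be the expected squared-$L_2$ loss at state $i$, and define the minimax stationary-weighted and worst-state estimation risks $$\tilde\varepsilon_n=\min_{\hat M}\ \max_{(M)\in\mathbb{M}^k_{\delta,\pi^*}}\ \sum_{i\in[k]}\pi_i\, r_i(M,\hat M),\qquad \varepsilon_n=\min_{\hat M}\ \max_{(M)\in\mathbb{M}^k_{\delta,\pi^*}}\ \max_{i\in[k]}\, r_i(M,\hat M).$$ Write $a_n\lesssim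 b_n$ if $a_n\le b_n(1+o(1))$ as $n\to\infty$, with $k,\delta,\pi^*$ fixed. Then $$(1-\pi^*)^2\,\frac{k-\frac{k}{k-1}}{n}\ \lesssim\ \tilde\varepsilon_n\ \lesssim\ \frac{k-1}{n}$$ and $$(1-\pi^*)^2\,\frac{1-\frac1{k-1}}{n\pi^*}\ \lesssim\ \varepsilon_n\ \lesssim\ \frac{1-\frac1k}{n\pi^*}.$$ -/

import Mathlib

open Filter Topology

/-- A time-homogeneous Markov chain over `k` states: an arbitrary initial distribution `init`,
a transition matrix `trans`, and a stationary distribution `stat` of `trans`. When all transition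
probabilities are positive, `stat` is determined by `trans` (see `stationary_unique`). -/
structure MarkovChain (k : ℕ) where
  init : Fin k → ℝ
  trans : Matrix (Fin k) (Fin k) ℝ
  stat : Fin k → ℝ
  init_mem : init ∈ stdSimplex ℝ (Fin k)
  trans_mem : trans ∈ Matrix.rowStochastic ℝ (Fin k)
  stat_mem : stat ∈ stdSimplex ℝ (Fin k)
  stat_vecMul : Matrix.vecMul stat trans = stat

/-- A transition matrix with positive entries has at most one stationary distribution. -/
theorem stationary_unique {k : ℕ} {M : Matrix (Fin k) (Fin k) ℝ}
    (hM : M ∈ Matrix.rowStochastic ℝ (Fin k)) {δ : ℝ} (hδ : 0 < δ) (hMδ : ∀ i j, δ ≤ M i j)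
    {p q : Fin k → ℝ} (hp : p ∈ stdSimplex ℝ (Fin k)) (hq : q ∈ stdSimplex ℝ (Fin k))
    (hpM : Matrix.vecMul p M = p) (hqM : Matrix.vecMul q M = q) : p = q := by
  have key : ∀ j, |p j - q j| ≤ ∑ i, |p i - q i| * (M i j - δ) := by
    intro j
    have h1 : p j - q j = ∑ i, (p i - q i) * (M i j - δ) := by
      have e1 : p j = ∑ i, p i * M i j := by
        conv_lhs => rw [← hpM]
        rfl
      have e2 : q j = ∑ i, q i * M i j := by
        conv_lhs => rw [← hqM]
        rfl
      simp only [sub_mul, mul_sub, Finset.sum_sub_distrib, ← Finset.sum_mul, hp.2, hq.2]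
      rw [← e1, ← e2]
      ring
    rw [h1]
    refine (Finset.abs_sum_le_sum_abs _ _).trans (Finset.sum_le_sum fun i _ => ?_)
    rw [abs_mul, abs_of_nonneg (sub_nonneg.2 (hMδ i j))]
  have h2 : ∑ j, |p j - q j| ≤ ∑ j, ∑ i, |p i - q i| * (M i j - δ) :=
    Finset.sum_le_sum fun j _ => key j
  rw [Finset.sum_comm] at h2
  simp only [← Finset.mul_sum, Finset.sum_sub_distrib,
    Matrix.sum_row_of_mem_rowStochastic hM, Finset.sum_const, Finset.card_univ,
    Fintype.card_fin, nsmul_eq_mul, ← Finset.sum_mul] at h2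
  have h0 : 0 ≤ ∑ j, |p j - q j| := Finset.sum_nonneg fun j _ => abs_nonneg _
  funext j
  have hk : (0 : ℝ) < k := by exact_mod_cast (Fin.pos j)
  have h3 : ∑ j, |p j - q j| = 0 := by nlinarith [mul_pos hk hδ]
  have h4 := (Finset.sum_eq_zero_iff_of_nonneg (fun j _ => abs_nonneg (p j - q j))).1 h3 j
    (Finset.mem_univ j)
  exact sub_eq_zero.1 (abs_eq_zero.1 h4)

namespace MarkovChain

/-- The probability that the first `n` states of the chain are `x 0, …, x (n - 1)`. -/
def pathProb {k : ℕ} (C : MarkovChain k) : (n : ℕ) → (Fin n → Fin k) → ℝ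
  | 0, _ => 1
  | m + 1, x => C.init (x 0) * ∏ t : Fin m, C.trans (x t.castSucc) (x t.succ)

/-- The chains over `k` states whose transition probabilities are all at least `δ`. -/
def lowerBounded (k : ℕ) (δ : ℝ) : Set (MarkovChain k) :=
  {C | ∀ i j, δ ≤ C.trans i j}

/-- The chains in `lowerBounded k δ` whose smallest stationary probability equals `pmin`. -/
def lowerBoundedStat (k : ℕ) (δ pmin : ℝ) : Set (MarkovChain k) :=
  {C | C ∈ lowerBounded k δ ∧ IsLeast (Set.range C.stat) pmin}

end MarkovChain

/-- An estimator of the transition matrix from a sample of length `n` over `k` states. -/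
abbrev TransitionEstimator (k n : ℕ) : Type :=
  (Fin n → Fin k) → Matrix.rowStochastic ℝ (Fin k)

/-- The squared Euclidean distance of two distributions on `k` points. -/
def l2Loss {k : ℕ} (p q : Fin k → ℝ) : ℝ := ∑ j, (p j - q j) ^ 2

/-- The expected squared-`L₂` loss at state `i`, for a sample of length `n` from the chain. -/
def stateRisk {k n : ℕ} (C : MarkovChain k) (E : TransitionEstimator k n) (i : Fin k) : ℝ :=
  ∑ x : Fin n → Fin k, C.pathProb n x * l2Loss (C.trans i) ((E x : Matrix (Fin k) (Fin k) ℝ) i)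

/-- The worst-state estimation risk. -/
noncomputable def worstStateRisk {k n : ℕ} (C : MarkovChain k) (E : TransitionEstimator k n) : ℝ :=
  ⨆ i : Fin k, stateRisk C E i

/-- The stationary-weighted estimation risk. -/
def weightedRisk {k n : ℕ} (C : MarkovChain k) (E : TransitionEstimator k n) : ℝ :=
  ∑ i : Fin k, C.stat i * stateRisk C E i

/-- The minimax worst-state estimation risk over a class of chains, for samples of length `n`. -/
noncomputable def minimaxWorstStateRisk {k : ℕ} (𝓜 : Set (MarkovChain k)) (n : ℕ) : ℝ :=
  ⨅ E : TransitionEstimator k n, ⨆ C : 𝓜, worstStateRisk C.1 E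

/-- The minimax stationary-weighted estimation risk over a class of chains, for samples of
length `n`. -/
noncomputable def minimaxWeightedRisk {k : ℕ} (𝓜 : Set (MarkovChain k)) (n : ℕ) : ℝ :=
  ⨅ E : TransitionEstimator k n, ⨆ C : 𝓜, weightedRisk C.1 E

/-- `a ≤ b (1 + o(1))` as `n → ∞`. -/
def AsympLE (a b : ℕ → ℝ) : Prop :=
  ∃ r : ℕ → ℝ, Tendsto r atTop (𝓝 0) ∧ ∀ᶠ n in atTop, a n ≤ b n * (1 + r n)

/-! Upper bounds. The empirical estimator is used for every chain. For a state `i` with visit count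
N_i, the count of transitions i → j minus M_ij N_i is a martingale with quadratic characteristic
M_ij (1 - M_ij) N_i. Its second moment is therefore M_ij (1 - M_ij) E N_i, and these coefficients
sum over j to at most 1 - 1/k. Solving the Poisson equation, with a solution bounded by 1/δ, shows
that E N_i is nπ_i + O(1) and that N_i < (1 - ε) nπ_i is exponentially unlikely, uniformly over the
class. Hence the risk at `i` is at most (1 + o(1)) (1 - 1/k) / (nπ_i)
(`eventually_stateRisk_empiricalEstimator_le`); weighting by π or using π_i ≥ π* gives the two
bounds.

Lower bounds. The maximum over the class dominates an average over a finite grid of chains, of mesh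
a/√n, around a chain with independent states of law c. A discrete van Trees inequality
(`card_mul_sq_le_sum_sq_error_mul`) needs only the chi-square divergence between neighbouring path
laws, which `sum_sq_pathProb_div_le` controls by n times the Fisher information. Together they give
the Cramér-Rao bound up to any constant factor below 1 in each of finitely many orthonormal
directions (`exists_perturbation_family`), and Bessel's inequality adds these up.

The directions must preserve the constraint on the stationary law. If π* < 1/k, the column of a
state of mass π* is kept constant, which leaves k - 2 directions per row. If π* = 1/k, all column
sums are kept, which leaves (k - 1)² directions. In both cases Cramér-Rao exceeds the claimed bound
by a constant factor, so the lower bounds hold without the o(1). -/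

/-! ### Weighted sums over paths. -/

/-- The product of the weights `W` along the path that starts at `a` and continues with `y`. -/
def pathWeight {k : ℕ} (W : Matrix (Fin k) (Fin k) ℝ) :
    (m : ℕ) → Fin k → (Fin m → Fin k) → ℝ
  | 0, _, _ => 1
  | m + 1, a, y => W a (y 0) * pathWeight W m (y 0) (Fin.tail y)

/-- The sum of `g` over the transitions of the path that starts at `a` and continues with `y`. -/
def pathAdd {k : ℕ} (g : Fin k → Fin k → ℝ) : (m : ℕ) → Fin k → (Fin m → Fin k) → ℝ
  | 0, _, _ => 0
  | m + 1, a, y => g a (y 0) + pathAdd g m (y 0) (Fin.tail y)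

/-- The `W`-weighted sum of `F` over all continuations of length `m` of a path at `a`. -/
def pathExp {k : ℕ} (W : Matrix (Fin k) (Fin k) ℝ) (m : ℕ) (a : Fin k)
    (F : (Fin m → Fin k) → ℝ) : ℝ :=
  ∑ y, pathWeight W m a y * F y

theorem sum_pi_fin_succ {α : Type*} [Fintype α] {m : ℕ} (F : (Fin (m + 1) → α) → ℝ) :
    ∑ x, F x = ∑ b, ∑ y : Fin m → α, F (Fin.cons b y) := by
  rw [← Fintype.sum_prod_type']
  exact (Fintype.sum_equiv (Fin.consEquiv fun _ : Fin (m + 1) => α) _ _ fun _ => rfl).symm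

theorem prod_path_eq_pathWeight {k : ℕ} (W : Matrix (Fin k) (Fin k) ℝ) (m : ℕ)
    (x : Fin (m + 1) → Fin k) :
    ∏ t : Fin m, W (x t.castSucc) (x t.succ) = pathWeight W m (x 0) (Fin.tail x) := by
  induction m with
  | zero => simp [pathWeight]
  | succ m ih =>
    rw [Fin.prod_univ_succ, pathWeight, ← ih (Fin.tail x)]
    rfl

theorem pathProb_cons {k : ℕ} (C : MarkovChain k) (m : ℕ) (a : Fin k) (y : Fin m → Fin k) :
    C.pathProb (m + 1) (Fin.cons a y) = C.init a * pathWeight C.trans m a y := by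
  have h := prod_path_eq_pathWeight C.trans m (Fin.cons a y)
  simp only [Fin.cons_zero, Fin.tail_cons] at h
  simp only [MarkovChain.pathProb, Fin.cons_zero, h]

theorem sum_pathProb_mul {k : ℕ} (C : MarkovChain k) (m : ℕ) (F : (Fin (m + 1) → Fin k) → ℝ) :
    ∑ x, C.pathProb (m + 1) x * F x =
      ∑ a, C.init a * pathExp C.trans m a (fun y => F (Fin.cons a y)) := by
  rw [sum_pi_fin_succ]
  simp only [pathProb_cons, pathExp, Finset.mul_sum, mul_assoc]

theorem pathExp_zero {k : ℕ} (W : Matrix (Fin k) (Fin k) ℝ) (a : Fin k)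
    (F : (Fin 0 → Fin k) → ℝ) : pathExp W 0 a F = F Fin.elim0 := by
  simp [pathExp, pathWeight, Subsingleton.elim default Fin.elim0]

theorem pathExp_succ {k : ℕ} (W : Matrix (Fin k) (Fin k) ℝ) (m : ℕ) (a : Fin k)
    (F : (Fin (m + 1) → Fin k) → ℝ) :
    pathExp W (m + 1) a F = ∑ b, W a b * pathExp W m b (fun y => F (Fin.cons b y)) := by
  simp only [pathExp]
  rw [sum_pi_fin_succ]
  simp only [pathWeight, Fin.cons_zero, Fin.tail_cons, Finset.mul_sum, mul_assoc]

theorem pathWeight_nonneg {k : ℕ} {W : Matrix (Fin k) (Fin k) ℝ} (hW : ∀ i j, 0 ≤ W i j) (m : ℕ)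
    (a : Fin k) (y : Fin m → Fin k) : 0 ≤ pathWeight W m a y := by
  induction m generalizing a with
  | zero => simp [pathWeight]
  | succ m ih => exact mul_nonneg (hW _ _) (ih _ _)

theorem pathExp_mono {k : ℕ} {W : Matrix (Fin k) (Fin k) ℝ} (hW : ∀ i j, 0 ≤ W i j) (m : ℕ)
    (a : Fin k) {F G : (Fin m → Fin k) → ℝ} (h : ∀ y, F y ≤ G y) :
    pathExp W m a F ≤ pathExp W m a G :=
  Finset.sum_le_sum fun y _ => mul_le_mul_of_nonneg_left (h y) (pathWeight_nonneg hW m a y)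

theorem pathExp_add {k : ℕ} (W : Matrix (Fin k) (Fin k) ℝ) (m : ℕ) (a : Fin k)
    (F G : (Fin m → Fin k) → ℝ) :
    pathExp W m a (fun y => F y + G y) = pathExp W m a F + pathExp W m a G := by
  simp only [pathExp, mul_add, Finset.sum_add_distrib]

theorem pathExp_const_mul {k : ℕ} (W : Matrix (Fin k) (Fin k) ℝ) (m : ℕ) (a : Fin k) (c : ℝ)
    (F : (Fin m → Fin k) → ℝ) :
    pathExp W m a (fun y => c * F y) = c * pathExp W m a F := by
  simp only [pathExp, Finset.mul_sum]
  exact Finset.sum_congr rfl fun _ _ => by ring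

theorem pathExp_sum {k : ℕ} (W : Matrix (Fin k) (Fin k) ℝ) (m : ℕ) (a : Fin k) {ι : Type*}
    (s : Finset ι) (F : ι → (Fin m → Fin k) → ℝ) :
    pathExp W m a (fun y => ∑ i ∈ s, F i y) = ∑ i ∈ s, pathExp W m a (F i) := by
  simp only [pathExp, Finset.mul_sum]
  exact Finset.sum_comm

theorem pathExp_const {k : ℕ} {M : Matrix (Fin k) (Fin k) ℝ}
    (hM : M ∈ Matrix.rowStochastic ℝ (Fin k)) (m : ℕ) (a : Fin k) (c : ℝ) :
    pathExp M m a (fun _ => c) = c := by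
  induction m generalizing a with
  | zero => exact pathExp_zero _ _ _
  | succ m ih =>
    simp only [pathExp_succ, ih, ← Finset.sum_mul, Matrix.sum_row_of_mem_rowStochastic hM, one_mul]

/-- A supersolution of the eigenvalue equation for `W` bounds the growth of its path sums. -/
theorem pathExp_one_le_pow {k : ℕ} {W : Matrix (Fin k) (Fin k) ℝ} (hW : ∀ i j, 0 ≤ W i j)
    {f : Fin k → ℝ} {ρ : ℝ} (hρ : 0 ≤ ρ) (hf : ∀ a, 1 ≤ f a)
    (h : ∀ a, ∑ b, W a b * f b ≤ ρ * f a) (m : ℕ) (a : Fin k) :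
    pathExp W m a (fun _ => 1) ≤ ρ ^ m * f a := by
  induction m generalizing a with
  | zero => simpa [pathExp_zero] using hf a
  | succ m ih =>
    rw [pathExp_succ]
    calc ∑ b, W a b * pathExp W m b (fun _ => 1) ≤ ∑ b, W a b * (ρ ^ m * f b) :=
          Finset.sum_le_sum fun b _ => mul_le_mul_of_nonneg_left (ih b) (hW a b)
      _ = ρ ^ m * ∑ b, W a b * f b := by
          rw [Finset.mul_sum]; exact Finset.sum_congr rfl fun _ _ => by ring
      _ ≤ ρ ^ m * (ρ * f a) := mul_le_mul_of_nonneg_left (h a) (pow_nonneg hρ m)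
      _ = ρ ^ (m + 1) * f a := by ring

/-- Exponential tilting: an exponential moment of an additive functional becomes a total path sum
for a tilted matrix, to which `pathExp_one_le_pow` applies. -/
theorem pathWeight_mul_exp_pathAdd {k : ℕ} (W : Matrix (Fin k) (Fin k) ℝ)
    (g : Fin k → Fin k → ℝ) (m : ℕ) (a : Fin k) (y : Fin m → Fin k) :
    pathWeight W m a y * Real.exp (pathAdd g m a y) =
      pathWeight (fun i j => W i j * Real.exp (g i j)) m a y := by
  induction m generalizing a with
  | zero => simp [pathWeight, pathAdd]
  | succ m ih =>
    simp only [pathWeight, pathAdd, Real.exp_add]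
    rw [← ih]
    ring

/-- The chi-square integrand of two path laws is itself a product along the path, so it too is
governed by `pathExp_one_le_pow`. -/
theorem pathWeight_sq_div {k : ℕ} (W' W : Matrix (Fin k) (Fin k) ℝ) (m : ℕ) (a : Fin k)
    (y : Fin m → Fin k) :
    pathWeight W' m a y ^ 2 / pathWeight W m a y =
      pathWeight (fun i j => W' i j ^ 2 / W i j) m a y := by
  induction m generalizing a with
  | zero => simp [pathWeight]
  | succ m ih =>
    simp only [pathWeight]
    rw [← ih, mul_pow, mul_div_mul_comm]

theorem pathAdd_add {k : ℕ} (g h : Fin k → Fin k → ℝ) (m : ℕ) (a : Fin k) (y : Fin m → Fin k) :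
    pathAdd (fun i j => g i j + h i j) m a y = pathAdd g m a y + pathAdd h m a y := by
  induction m generalizing a with
  | zero => simp [pathAdd]
  | succ m ih => simp only [pathAdd, ih]; ring

theorem pathAdd_const_mul {k : ℕ} (c : ℝ) (g : Fin k → Fin k → ℝ) (m : ℕ) (a : Fin k)
    (y : Fin m → Fin k) :
    pathAdd (fun i j => c * g i j) m a y = c * pathAdd g m a y := by
  induction m generalizing a with
  | zero => simp [pathAdd]
  | succ m ih => simp only [pathAdd, ih]; ring

theorem pathAdd_sum {k : ℕ} {ι : Type*} (s : Finset ι) (g : ι → Fin k → Fin k → ℝ) (m : ℕ)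
    (a : Fin k) (y : Fin m → Fin k) :
    pathAdd (fun i j => ∑ l ∈ s, g l i j) m a y = ∑ l ∈ s, pathAdd (g l) m a y := by
  induction m generalizing a with
  | zero => simp [pathAdd]
  | succ m ih => simp only [pathAdd, ih, Finset.sum_add_distrib]

theorem pathAdd_nonneg {k : ℕ} {g : Fin k → Fin k → ℝ} (hg : ∀ i j, 0 ≤ g i j) (m : ℕ)
    (a : Fin k) (y : Fin m → Fin k) : 0 ≤ pathAdd g m a y := by
  induction m generalizing a with
  | zero => simp [pathAdd]
  | succ m ih => exact add_nonneg (hg _ _) (ih _ _)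

theorem pathExp_pathAdd_succ {k : ℕ} {M : Matrix (Fin k) (Fin k) ℝ}
    (hM : M ∈ Matrix.rowStochastic ℝ (Fin k)) (q : Fin k → ℝ) (m : ℕ) (a : Fin k) :
    pathExp M (m + 1) a (pathAdd (fun i _ => q i) (m + 1) a) =
      q a + ∑ b, M a b * pathExp M m b (pathAdd (fun i _ => q i) m b) := by
  simp only [pathExp_succ, pathAdd, Fin.cons_zero, Fin.tail_cons, pathExp_add, pathExp_const hM,
    mul_add, Finset.sum_add_distrib, ← Finset.sum_mul, Matrix.sum_row_of_mem_rowStochastic hM,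
    one_mul]

/-- The second moment of a martingale is the expectation of its quadratic characteristic. -/
theorem pathExp_sq_pathAdd {k : ℕ} {M : Matrix (Fin k) (Fin k) ℝ}
    (hM : M ∈ Matrix.rowStochastic ℝ (Fin k)) {g : Fin k → Fin k → ℝ} {q : Fin k → ℝ}
    (hg : ∀ a, ∑ b, M a b * g a b = 0) (hq : ∀ a, ∑ b, M a b * g a b ^ 2 = q a)
    (m : ℕ) (a : Fin k) (d : ℝ) :
    pathExp M m a (fun y => (d + pathAdd g m a y) ^ 2) =
      d ^ 2 + pathExp M m a (pathAdd (fun i _ => q i) m a) := by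
  -- The offset `d` absorbs the first increment; expanding the square, `hg` kills the cross term and
  -- `hq` evaluates the quadratic one.
  induction m generalizing a d with
  | zero => simp [pathExp_zero, pathAdd]
  | succ m ih =>
    rw [pathExp_pathAdd_succ hM, pathExp_succ]
    simp only [pathAdd, Fin.cons_zero, Fin.tail_cons, ← add_assoc, ih]
    have e : ∀ b, M a b * ((d + g a b) ^ 2 + pathExp M m b (pathAdd (fun i _ => q i) m b)) =
        M a b * d ^ 2 + (2 * d) * (M a b * g a b) + M a b * g a b ^ 2 +
          M a b * pathExp M m b (pathAdd (fun i _ => q i) m b) := fun b => by ring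
    simp only [e, Finset.sum_add_distrib, ← Finset.mul_sum, ← Finset.sum_mul, hg, hq,
      Matrix.sum_row_of_mem_rowStochastic hM]
    ring

/-! ### Elementary bounds on losses and risks. -/

theorem pathProb_nonneg {k : ℕ} (C : MarkovChain k) (n : ℕ) (x : Fin n → Fin k) :
    0 ≤ C.pathProb n x := by
  cases n with
  | zero => simp [MarkovChain.pathProb]
  | succ m =>
    exact mul_nonneg (C.init_mem.1 _)
      (Finset.prod_nonneg fun _ _ => Matrix.nonneg_of_mem_rowStochastic C.trans_mem)

theorem sum_pathProb {k : ℕ} (C : MarkovChain k) (n : ℕ) : ∑ x, C.pathProb n x = 1 := by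
  cases n with
  | zero => simp [MarkovChain.pathProb]
  | succ m =>
    have h := sum_pathProb_mul C m (fun _ => 1)
    simp only [mul_one, pathExp_const C.trans_mem, C.init_mem.2] at h
    exact h

theorem l2Loss_nonneg {k : ℕ} (p q : Fin k → ℝ) : 0 ≤ l2Loss p q :=
  Finset.sum_nonneg fun _ _ => sq_nonneg _

theorem l2Loss_le_two {k : ℕ} {p q : Fin k → ℝ} (hp : p ∈ stdSimplex ℝ (Fin k))
    (hq : q ∈ stdSimplex ℝ (Fin k)) : l2Loss p q ≤ 2 := by
  have h : ∀ j, (p j - q j) ^ 2 ≤ p j + q j := fun j => by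
    have h1 := hp.1 j
    have h2 := hq.1 j
    have h3 : p j ≤ 1 := (mem_Icc_of_mem_stdSimplex hp j).2
    have h4 : q j ≤ 1 := (mem_Icc_of_mem_stdSimplex hq j).2
    nlinarith [mul_nonneg h1 h2, mul_nonneg h1 (sub_nonneg.2 h3), mul_nonneg h2 (sub_nonneg.2 h4)]
  calc l2Loss p q ≤ ∑ j, (p j + q j) := Finset.sum_le_sum fun j _ => h j
    _ = 2 := by rw [Finset.sum_add_distrib, hp.2, hq.2]; norm_num

theorem row_mem_stdSimplex {k : ℕ} {M : Matrix (Fin k) (Fin k) ℝ}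
    (hM : M ∈ Matrix.rowStochastic ℝ (Fin k)) (i : Fin k) : M i ∈ stdSimplex ℝ (Fin k) :=
  ⟨fun _ => Matrix.nonneg_of_mem_rowStochastic hM, Matrix.sum_row_of_mem_rowStochastic hM i⟩

theorem mem_rowStochastic_of_row_mem {k : ℕ} {M : Matrix (Fin k) (Fin k) ℝ}
    (hM : ∀ i, M i ∈ stdSimplex ℝ (Fin k)) : M ∈ Matrix.rowStochastic ℝ (Fin k) :=
  Matrix.mem_rowStochastic_iff_sum.2 ⟨fun i j => (hM i).1 j, fun i => (hM i).2⟩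

theorem stateRisk_nonneg {k n : ℕ} (C : MarkovChain k) (E : TransitionEstimator k n) (i : Fin k) :
    0 ≤ stateRisk C E i :=
  Finset.sum_nonneg fun x _ => mul_nonneg (pathProb_nonneg C n x) (l2Loss_nonneg _ _)

theorem stateRisk_le_two {k n : ℕ} (C : MarkovChain k) (E : TransitionEstimator k n) (i : Fin k) :
    stateRisk C E i ≤ 2 := by
  calc stateRisk C E i ≤ ∑ x : Fin n → Fin k, C.pathProb n x * 2 :=
        Finset.sum_le_sum fun x _ => mul_le_mul_of_nonneg_left
          (l2Loss_le_two (row_mem_stdSimplex C.trans_mem i) (row_mem_stdSimplex (E x).2 i))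
          (pathProb_nonneg C n x)
    _ = 2 := by rw [← Finset.sum_mul, sum_pathProb, one_mul]

theorem weightedRisk_nonneg {k n : ℕ} (C : MarkovChain k) (E : TransitionEstimator k n) :
    0 ≤ weightedRisk C E :=
  Finset.sum_nonneg fun i _ => mul_nonneg (C.stat_mem.1 i) (stateRisk_nonneg C E i)

theorem weightedRisk_le_two {k n : ℕ} (C : MarkovChain k) (E : TransitionEstimator k n) :
    weightedRisk C E ≤ 2 := by
  calc weightedRisk C E ≤ ∑ i, C.stat i * 2 :=
        Finset.sum_le_sum fun i _ => mul_le_mul_of_nonneg_left (stateRisk_le_two C E i)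
          (C.stat_mem.1 i)
    _ = 2 := by rw [← Finset.sum_mul, C.stat_mem.2, one_mul]

theorem worstStateRisk_nonneg {k n : ℕ} (C : MarkovChain k) (E : TransitionEstimator k n) :
    0 ≤ worstStateRisk C E :=
  Real.iSup_nonneg fun i => stateRisk_nonneg C E i

theorem stateRisk_le_worstStateRisk {k n : ℕ} (C : MarkovChain k) (E : TransitionEstimator k n)
    (i : Fin k) : stateRisk C E i ≤ worstStateRisk C E :=
  le_ciSup (f := fun i => stateRisk C E i) (Set.finite_range _).bddAbove i

theorem worstStateRisk_le_two {k n : ℕ} (C : MarkovChain k) (E : TransitionEstimator k n) :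
    worstStateRisk C E ≤ 2 :=
  Real.iSup_le (fun i => stateRisk_le_two C E i) (by norm_num)

theorem weightedRisk_le_worstStateRisk {k n : ℕ} (C : MarkovChain k)
    (E : TransitionEstimator k n) : weightedRisk C E ≤ worstStateRisk C E := by
  calc weightedRisk C E ≤ ∑ i, C.stat i * worstStateRisk C E :=
        Finset.sum_le_sum fun i _ => mul_le_mul_of_nonneg_left
          (stateRisk_le_worstStateRisk C E i) (C.stat_mem.1 i)
    _ = worstStateRisk C E := by rw [← Finset.sum_mul, C.stat_mem.2, one_mul]

/-! ### Stationary mass and the Poisson equation. -/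

/-- A lower bound on the transition probabilities into `j` bounds the stationary mass of `j`. -/
theorem MarkovChain.le_stat {k : ℕ} (C : MarkovChain k) {j : Fin k} {b : ℝ}
    (h : ∀ i, b ≤ C.trans i j) : b ≤ C.stat j := by
  have e : C.stat j = ∑ i, C.stat i * C.trans i j := by
    conv_lhs => rw [← C.stat_vecMul]
    rfl
  rw [e]
  calc b = ∑ i, C.stat i * b := by rw [← Finset.sum_mul, C.stat_mem.2, one_mul]
    _ ≤ _ := Finset.sum_le_sum fun i _ => mul_le_mul_of_nonneg_left (h i) (C.stat_mem.1 i)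

/-- Maximum principle: the entries M_ab - δ p_b are nonnegative with row sums 1 - δ, so the equation
read at a maximum of |g| bounds that maximum. -/
theorem mul_abs_le_of_discounted_fixed_point {k : ℕ} {M : Matrix (Fin k) (Fin k) ℝ}
    (hM : M ∈ Matrix.rowStochastic ℝ (Fin k)) {δ : ℝ} (hMδ : ∀ i j, δ ≤ M i j) (hδ : 0 < δ)
    {p : Fin k → ℝ} (hp : p ∈ stdSimplex ℝ (Fin k)) {g h : Fin k → ℝ} {H : ℝ}
    (hh : ∀ a, |h a| ≤ H) (hg : ∀ a, g a = h a + ∑ b, (M a b - δ * p b) * g b) (a : Fin k) :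
    δ * |g a| ≤ H := by
  have : Nonempty (Fin k) := ⟨a⟩
  obtain ⟨a₀, ha₀⟩ := Finite.exists_max fun a => |g a|
  have hA : ∀ b, 0 ≤ M a₀ b - δ * p b := fun b => by
    have h1 : p b ≤ 1 := (mem_Icc_of_mem_stdSimplex hp b).2
    nlinarith [hMδ a₀ b]
  have h2 : |∑ b, (M a₀ b - δ * p b) * g b| ≤ (1 - δ) * |g a₀| := by
    calc |∑ b, (M a₀ b - δ * p b) * g b| ≤ ∑ b, |(M a₀ b - δ * p b) * g b| :=
          Finset.abs_sum_le_sum_abs _ _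
      _ ≤ ∑ b, (M a₀ b - δ * p b) * |g a₀| := Finset.sum_le_sum fun b _ => by
          rw [abs_mul, abs_of_nonneg (hA b)]
          exact mul_le_mul_of_nonneg_left (ha₀ b) (hA b)
      _ = (1 - δ) * |g a₀| := by
          rw [← Finset.sum_mul, Finset.sum_sub_distrib, ← Finset.mul_sum, hp.2,
            Matrix.sum_row_of_mem_rowStochastic hM, mul_one]
  have h3 : |g a₀| ≤ H + (1 - δ) * |g a₀| := by
    conv_lhs => rw [hg a₀]
    exact (abs_add_le _ _).trans (add_le_add (hh a₀) h2)
  have h4 : δ * |g a| ≤ δ * |g a₀| := mul_le_mul_of_nonneg_left (ha₀ a) hδ.le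
  linarith

/-- The Poisson equation of a chain with transition probabilities at least `δ`. -/
theorem exists_poisson_solution {k : ℕ} {M : Matrix (Fin k) (Fin k) ℝ}
    (hM : M ∈ Matrix.rowStochastic ℝ (Fin k)) {δ : ℝ} (hMδ : ∀ i j, δ ≤ M i j) (hδ : 0 < δ)
    {p : Fin k → ℝ} (hp : p ∈ stdSimplex ℝ (Fin k)) (hpM : Matrix.vecMul p M = p)
    {h : Fin k → ℝ} (hh : ∀ a, |h a| ≤ 1) (hph : ∑ a, p a * h a = 0) :
    ∃ g : Fin k → ℝ, (∀ a, g a = h a + ∑ b, M a b * g b) ∧ ∀ a, |g a| ≤ 1 / δ := by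
  -- Removing the rank-one part makes `A` a strict contraction in the sup norm, so id - A is
  -- injective, hence surjective in finite dimension.
  set A : Matrix (Fin k) (Fin k) ℝ := Matrix.of fun a b => M a b - δ * p b with hA
  set T : (Fin k → ℝ) →ₗ[ℝ] (Fin k → ℝ) := LinearMap.id - A.mulVecLin with hT
  have hTa : ∀ g a, T g a = g a - ∑ b, (M a b - δ * p b) * g b := fun g a => rfl
  have hinj : Function.Injective T := by
    rw [← LinearMap.ker_eq_bot, LinearMap.ker_eq_bot']
    intro g hg
    funext a
    have h1 := mul_abs_le_of_discounted_fixed_point hM hMδ hδ hp (g := g) (h := fun _ => 0)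
      (H := 0) (by simp) (fun a => by
        have := congrFun hg a
        rw [hTa] at this
        simp only [Pi.zero_apply] at this
        linarith) a
    have h2 : |g a| ≤ 0 := by
      by_contra hc
      push Not at hc
      nlinarith
    simpa using h2
  obtain ⟨g, hg⟩ := (LinearMap.injective_iff_surjective.1 hinj) h
  have hga : ∀ a, g a = h a + ∑ b, (M a b - δ * p b) * g b := fun a => by
    have := congrFun hg a
    rw [hTa] at this
    linarith
  have hsplit : ∀ a, ∑ b, (M a b - δ * p b) * g b =
      ∑ b, M a b * g b - δ * ∑ b, p b * g b := fun a => by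
    simp only [sub_mul, Finset.sum_sub_distrib, Finset.mul_sum, mul_assoc]
  -- Pairing the equation with the stationary `p` leaves δ (p·g) = p·h = 0, so the removed rank-one
  -- part does not act on `g`.
  have hpg : ∑ b, p b * g b = 0 := by
    have e1 : ∑ a, p a * ∑ b, M a b * g b = ∑ b, p b * g b := by
      simp only [Finset.mul_sum]
      rw [Finset.sum_comm]
      refine Finset.sum_congr rfl fun b _ => ?_
      conv_rhs => rw [← hpM]
      simp only [Matrix.vecMul, dotProduct, Finset.sum_mul, mul_assoc]
    have e2 : ∑ a, p a * g a = ∑ a, p a * (h a + (∑ b, M a b * g b - δ * ∑ b, p b * g b)) :=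
      Finset.sum_congr rfl fun a _ => by rw [← hsplit, ← hga]
    simp only [mul_add, mul_sub, Finset.sum_add_distrib, Finset.sum_sub_distrib, e1, hph,
      ← Finset.sum_mul, hp.2] at e2
    have : δ * ∑ b, p b * g b = 0 := by linarith
    exact (mul_eq_zero.1 this).resolve_left hδ.ne'
  refine ⟨g, fun a => ?_, fun a => ?_⟩
  · rw [hga a, hsplit, hpg]
    ring
  · rw [le_div_iff₀ hδ, mul_comm]
    exact mul_abs_le_of_discounted_fixed_point hM hMδ hδ hp hh hga a

/-! ### The empirical estimator and its risk. -/

/-- The number of visits to `i` before the last state of a path. -/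
def visitCount {k : ℕ} (i : Fin k) (m : ℕ) (a : Fin k) (y : Fin m → Fin k) : ℝ :=
  pathAdd (fun b _ => if b = i then 1 else 0) m a y

/-- The number of transitions from `i` to `j` along a path. -/
def transCount {k : ℕ} (i j : Fin k) (m : ℕ) (a : Fin k) (y : Fin m → Fin k) : ℝ :=
  pathAdd (fun b c => if b = i then (if c = j then 1 else 0) else 0) m a y

/-- The empirical transition frequencies out of `i`; a point mass if `i` is not visited. -/
noncomputable def empiricalRow {k : ℕ} (i : Fin k) (m : ℕ) (a : Fin k) (y : Fin m → Fin k) :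
    Fin k → ℝ :=
  if visitCount i m a y = 0 then Pi.single i 1 else
    fun j => transCount i j m a y / visitCount i m a y

theorem sum_transCount {k : ℕ} (i : Fin k) (m : ℕ) (a : Fin k) (y : Fin m → Fin k) :
    ∑ j, transCount i j m a y = visitCount i m a y := by
  unfold transCount visitCount
  rw [← pathAdd_sum]
  congr 1
  funext b c
  by_cases hb : b = i <;> simp [hb]

theorem empiricalRow_mem {k : ℕ} (i : Fin k) (m : ℕ) (a : Fin k) (y : Fin m → Fin k) :
    empiricalRow i m a y ∈ stdSimplex ℝ (Fin k) := by
  unfold empiricalRow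
  split_ifs with h
  · exact single_mem_stdSimplex ℝ i
  · refine ⟨fun j => div_nonneg ?_ ?_, ?_⟩
    · exact pathAdd_nonneg (fun b c => by positivity) _ _ _
    · exact pathAdd_nonneg (fun b c => by positivity) _ _ _
    · rw [← Finset.sum_div, sum_transCount, div_self h]

/-- The empirical estimator of the transition matrix. -/
noncomputable def empiricalEstimator (k : ℕ) : (n : ℕ) → TransitionEstimator k n
  | 0 => fun _ => 1
  | m + 1 => fun x => ⟨fun i => empiricalRow i m (x 0) (Fin.tail x),
      mem_rowStochastic_of_row_mem fun i => empiricalRow_mem i m _ _⟩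

theorem stateRisk_empiricalEstimator {k : ℕ} (C : MarkovChain k) (m : ℕ) (i : Fin k) :
    stateRisk C (empiricalEstimator k (m + 1)) i =
      ∑ a, C.init a * pathExp C.trans m a (fun y => l2Loss (C.trans i) (empiricalRow i m a y)) := by
  unfold stateRisk
  rw [sum_pathProb_mul C m fun x =>
    l2Loss (C.trans i) ((empiricalEstimator k (m + 1) x : Matrix (Fin k) (Fin k) ℝ) i)]
  simp only [empiricalEstimator, Fin.cons_zero, Fin.tail_cons]

/-- With at least `t` visits the loss is the squared martingale over N², at most the same over t².
Otherwise the trivial bound 2 is multiplied by exp(l(t - N)) ≥ 1, ready for a Chernoff estimate. -/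
theorem l2Loss_empiricalRow_le {k : ℕ} {M : Matrix (Fin k) (Fin k) ℝ}
    (hM : M ∈ Matrix.rowStochastic ℝ (Fin k)) (i : Fin k) (m : ℕ) (a : Fin k)
    (y : Fin m → Fin k) {t l : ℝ} (ht : 0 < t) (hl : 0 ≤ l) :
    l2Loss (M i) (empiricalRow i m a y) ≤
      (1 / t ^ 2) * ∑ j, (transCount i j m a y - M i j * visitCount i m a y) ^ 2 +
        (2 * Real.exp (l * t)) * Real.exp (-l * visitCount i m a y) := by
  rcases le_or_gt t (visitCount i m a y) with h | h
  · have hN : 0 < visitCount i m a y := ht.trans_le h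
    have e : l2Loss (M i) (empiricalRow i m a y) =
        (1 / visitCount i m a y ^ 2) *
          ∑ j, (transCount i j m a y - M i j * visitCount i m a y) ^ 2 := by
      unfold l2Loss empiricalRow
      rw [if_neg hN.ne', Finset.mul_sum]
      refine Finset.sum_congr rfl fun j _ => ?_
      field_simp
      ring
    rw [e]
    have h1 : 1 / visitCount i m a y ^ 2 ≤ 1 / t ^ 2 := by gcongr
    have h2 := mul_le_mul_of_nonneg_right h1 (Finset.sum_nonneg fun j (_ : j ∈ Finset.univ) =>
      sq_nonneg (transCount i j m a y - M i j * visitCount i m a y))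
    have h3 : 0 ≤ (2 * Real.exp (l * t)) * Real.exp (-l * visitCount i m a y) := by positivity
    linarith
  · have h1 := l2Loss_le_two (row_mem_stdSimplex hM i) (empiricalRow_mem i m a y)
    have h2 : 1 ≤ Real.exp (l * t) * Real.exp (-l * visitCount i m a y) := by
      rw [← Real.exp_add]
      apply Real.one_le_exp
      nlinarith
    have h3 : 0 ≤ (1 / t ^ 2) * ∑ j, (transCount i j m a y - M i j * visitCount i m a y) ^ 2 := by
      positivity
    linarith

theorem pathExp_sq_transCount_sub {k : ℕ} {M : Matrix (Fin k) (Fin k) ℝ}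
    (hM : M ∈ Matrix.rowStochastic ℝ (Fin k)) (i j : Fin k) (m : ℕ) (a : Fin k) :
    pathExp M m a (fun y => (transCount i j m a y - M i j * visitCount i m a y) ^ 2) =
      (M i j * (1 - M i j)) * pathExp M m a (visitCount i m a) := by
  have e : ∀ y, transCount i j m a y - M i j * visitCount i m a y =
      0 + pathAdd (fun b c => (if b = i then (if c = j then 1 else 0) else 0) +
        (-M i j) * (if b = i then 1 else 0)) m a y := fun y => by
    rw [pathAdd_add, pathAdd_const_mul]
    unfold transCount visitCount
    ring
  simp only [e]
  rw [pathExp_sq_pathAdd hM (q := fun b => (M i j * (1 - M i j)) * if b = i then 1 else 0)]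
  · rw [← pathExp_const_mul, zero_pow two_ne_zero, zero_add]
    congr 1
    funext y
    exact pathAdd_const_mul _ (fun b _ => if b = i then 1 else 0) m a y
  · intro b
    by_cases hb : b = i
    · subst hb
      simp only [if_true, mul_add, Finset.sum_add_distrib, ← Finset.sum_mul,
        Matrix.sum_row_of_mem_rowStochastic hM]
      simp
    · simp [hb]
  · intro b
    by_cases hb : b = i
    · subst hb
      have e2 : ∀ c, M b c * ((if c = j then (1 : ℝ) else 0) + -M b j * 1) ^ 2 =
          (if c = j then M b c * (1 - 2 * M b j) else 0) + M b c * M b j ^ 2 := fun c => by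
        split_ifs <;> ring
      simp only [if_true, e2, Finset.sum_add_distrib, Finset.sum_ite_eq', Finset.mem_univ,
        ← Finset.sum_mul, Matrix.sum_row_of_mem_rowStochastic hM]
      ring
    · simp [hb]

/-- By the Poisson equation, E N = mπ + g(a) - E g(X_m), and `g` is bounded by `G`. -/
theorem pathExp_visitCount_le {k : ℕ} {M : Matrix (Fin k) (Fin k) ℝ}
    (hM : M ∈ Matrix.rowStochastic ℝ (Fin k)) {i : Fin k} {π G : ℝ} {g : Fin k → ℝ}
    (hg : ∀ a, g a = ((if a = i then 1 else 0) - π) + ∑ b, M a b * g b) (hG : ∀ a, |g a| ≤ G)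
    (m : ℕ) (a : Fin k) : pathExp M m a (visitCount i m a) ≤ m * π + 2 * G := by
  have key : ∀ m a, pathExp M m a (visitCount i m a) ≤ m * π + g a + G := by
    intro m
    induction m with
    | zero =>
      intro a
      simp only [pathExp_zero, visitCount, pathAdd]
      have := neg_le_of_abs_le (hG a)
      simp only [Nat.cast_zero]
      linarith
    | succ m ih =>
      intro a
      have e := pathExp_pathAdd_succ hM (fun b => if b = i then 1 else 0) m a
      change pathExp M (m + 1) a (visitCount i (m + 1) a) = _ at e
      have h1 : ∑ b, M a b * pathExp M m b (visitCount i m b) ≤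
          ∑ b, M a b * (m * π + g b + G) :=
        Finset.sum_le_sum fun b _ => mul_le_mul_of_nonneg_left (ih b)
          (Matrix.nonneg_of_mem_rowStochastic hM)
      simp only [mul_add, Finset.sum_add_distrib, ← Finset.sum_mul,
        Matrix.sum_row_of_mem_rowStochastic hM] at h1
      change _ = _ + ∑ b, M a b * pathExp M m b (visitCount i m b) at e
      rw [e]
      have := hg a
      push_cast
      linarith
  have := key m a
  have := le_of_abs_le (hG a)
  linarith

/-- The function exp(-l g), with `g` the Poisson solution, is an approximate eigenvector of the
matrix tilted by -l per visit to `i`, with eigenvalue about exp(-lπ); the quadratic error of the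
exponential costs (lG)². -/
theorem pathExp_exp_neg_visitCount_le {k : ℕ} {M : Matrix (Fin k) (Fin k) ℝ}
    (hM : M ∈ Matrix.rowStochastic ℝ (Fin k)) {i : Fin k} {π G l : ℝ} {g : Fin k → ℝ}
    (hg : ∀ a, g a = ((if a = i then 1 else 0) - π) + ∑ b, M a b * g b) (hG : ∀ a, |g a| ≤ G)
    (hl : 0 ≤ l) (hlG : l * G ≤ 1) (m : ℕ) (a : Fin k) :
    pathExp M m a (fun y => Real.exp (-l * visitCount i m a y)) ≤
      Real.exp 2 * Real.exp (m * (-l * π + (l * G) ^ 2)) := by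
  have hM0 : ∀ a b, 0 ≤ M a b := fun a b => Matrix.nonneg_of_mem_rowStochastic hM
  set W : Matrix (Fin k) (Fin k) ℝ :=
    fun b c => M b c * Real.exp (-l * if b = i then 1 else 0) with hW
  have e : pathExp M m a (fun y => Real.exp (-l * visitCount i m a y)) =
      pathExp W m a (fun _ => 1) := by
    unfold pathExp
    refine Finset.sum_congr rfl fun y _ => ?_
    unfold visitCount
    beta_reduce
    rw [← pathAdd_const_mul, pathWeight_mul_exp_pathAdd, mul_one]
  have hlg : ∀ a, |l * g a| ≤ l * G := fun a => by
    rw [abs_mul, abs_of_nonneg hl]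
    exact mul_le_mul_of_nonneg_left (hG a) hl
  -- This is exp x ≤ 1 + x + x² for |x| ≤ 1, applied to x = -l g(b).
  have hexp : ∀ b, Real.exp (l * G - l * g b) ≤
      Real.exp (l * G) * (1 - l * g b + (l * G) ^ 2) := fun b => by
    rw [sub_eq_add_neg, Real.exp_add]
    refine mul_le_mul_of_nonneg_left ?_ (Real.exp_pos _).le
    have h1 : |-(l * g b)| ≤ 1 := by rw [abs_neg]; exact (hlg b).trans hlG
    have h2 := le_of_abs_le (Real.abs_exp_sub_one_sub_id_le h1)
    have h3 : (-(l * g b)) ^ 2 ≤ (l * G) ^ 2 := by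
      rw [← sq_abs, abs_neg]
      exact pow_le_pow_left₀ (abs_nonneg _) (hlg b) 2
    linarith
  -- The shift by lG makes the supersolution at least 1; it is then at most exp(2lG) ≤ exp 2, the
  -- constant of the conclusion.
  have hpow := pathExp_one_le_pow (W := W) (f := fun b => Real.exp (l * G - l * g b))
    (ρ := Real.exp (-l * π + (l * G) ^ 2))
    (fun b c => mul_nonneg (hM0 b c) (Real.exp_pos _).le) (Real.exp_pos _).le
    (fun b => Real.one_le_exp (by have := le_of_abs_le (hlg b); linarith))
    (fun b => by
      calc ∑ c, W b c * Real.exp (l * G - l * g c)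
          ≤ ∑ c, W b c * (Real.exp (l * G) * (1 - l * g c + (l * G) ^ 2)) :=
            Finset.sum_le_sum fun c _ => mul_le_mul_of_nonneg_left (hexp c)
              (mul_nonneg (hM0 b c) (Real.exp_pos _).le)
        _ = Real.exp (-l * if b = i then 1 else 0) * Real.exp (l * G) *
            (((∑ c, M b c) * (1 + (l * G) ^ 2)) - l * ∑ c, M b c * g c) := by
            rw [Finset.sum_mul, Finset.mul_sum, ← Finset.sum_sub_distrib, Finset.mul_sum]
            refine Finset.sum_congr rfl fun c _ => ?_
            simp only [hW]
            ring
        _ ≤ Real.exp (-l * if b = i then 1 else 0) * Real.exp (l * G) *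
            Real.exp ((l * G) ^ 2 - l * ∑ c, M b c * g c) := by
            refine mul_le_mul_of_nonneg_left ?_ (by positivity)
            rw [Matrix.sum_row_of_mem_rowStochastic hM]
            have := Real.add_one_le_exp ((l * G) ^ 2 - l * ∑ c, M b c * g c)
            linarith
        _ = Real.exp (-l * π + (l * G) ^ 2) * Real.exp (l * G - l * g b) := by
            rw [← Real.exp_add, ← Real.exp_add, ← Real.exp_add]
            congr 1
            conv_rhs => rw [hg b]
            ring) m a
  rw [e]
  refine hpow.trans ?_
  rw [← Real.exp_nat_mul, mul_comm]
  refine mul_le_mul_of_nonneg_right (Real.exp_le_exp.2 ?_) (Real.exp_pos _).le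
  have := neg_le_of_abs_le (hlg a)
  linarith

theorem sum_mul_one_sub_le {k : ℕ} {p : Fin k → ℝ} (hp : p ∈ stdSimplex ℝ (Fin k)) :
    ∑ j, p j * (1 - p j) ≤ 1 - 1 / (k : ℝ) := by
  have hk : (0 : ℝ) < k := by
    rcases Nat.eq_zero_or_pos k with h | h
    · subst h
      have := hp.2
      simp at this
    · exact_mod_cast h
  have h := sq_sum_le_card_mul_sum_sq (s := Finset.univ) (f := p)
  rw [hp.2, Finset.card_univ, Fintype.card_fin] at h
  have h1 : 1 / (k : ℝ) ≤ ∑ j, p j ^ 2 := by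
    rw [div_le_iff₀ hk]
    linarith
  have e : ∑ j, p j * (1 - p j) = 1 - ∑ j, p j ^ 2 := by
    rw [← hp.2, ← Finset.sum_sub_distrib]
    exact Finset.sum_congr rfl fun j _ => by rw [hp.2]; ring
  linarith

theorem stateRisk_empiricalEstimator_le {k : ℕ} {δ ε : ℝ} (hδ : 0 < δ) (hε : 0 < ε) (hε1 : ε < 1)
    {C : MarkovChain k} (hC : C ∈ MarkovChain.lowerBounded k δ) (i : Fin k) {m : ℕ} (hm : 0 < m) :
    stateRisk C (empiricalEstimator k (m + 1)) i ≤
      (1 / ((1 - ε) * m * C.stat i) ^ 2) * ((1 - 1 / (k : ℝ)) * (m * C.stat i + 2 / δ)) +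
        2 * Real.exp 2 * Real.exp (-(ε ^ 2 * δ ^ 4 / 4) * m) := by
  have hM := C.trans_mem
  have hπ : δ ≤ C.stat i := C.le_stat fun a => hC a i
  have hπ1 : C.stat i ≤ 1 := (mem_Icc_of_mem_stdSimplex C.stat_mem i).2
  have hδ1 : δ ≤ 1 := hπ.trans hπ1
  have hm' : (0 : ℝ) < m := by exact_mod_cast hm
  obtain ⟨g, hg, hG⟩ := exists_poisson_solution hM hC hδ C.stat_mem C.stat_vecMul
    (h := fun a => (if a = i then 1 else 0) - C.stat i)
    (fun a => by
      rw [abs_le]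
      constructor <;> split_ifs <;> linarith)
    (by simp [mul_sub, ← Finset.sum_mul, C.stat_mem.2])
  set t : ℝ := (1 - ε) * m * C.stat i with ht
  have htpos : 0 < t := mul_pos (mul_pos (by linarith) hm') (by linarith)
  -- This `l` maximises the Chernoff rate lεδ - (l/δ)², with maximum ε²δ⁴/4.
  set l : ℝ := ε * δ ^ 3 / 2 with hl
  have hlpos : 0 ≤ l := by positivity
  have hlG : l * (1 / δ) = ε * δ ^ 2 / 2 := by rw [hl]; field_simp
  have hlG1 : l * (1 / δ) ≤ 1 := by
    rw [hlG]
    nlinarith [mul_nonneg hε.le hδ.le, mul_nonneg (sub_nonneg.2 hδ1) hδ.le]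
  have hpt : ∀ a, pathExp C.trans m a (fun y => l2Loss (C.trans i) (empiricalRow i m a y)) ≤
      (1 / t ^ 2) * ((1 - 1 / (k : ℝ)) * (m * C.stat i + 2 / δ)) +
        2 * Real.exp 2 * Real.exp (-(ε ^ 2 * δ ^ 4 / 4) * m) := by
    intro a
    refine (pathExp_mono (W := C.trans) (fun _ _ => Matrix.nonneg_of_mem_rowStochastic hM) m a
      fun y => l2Loss_empiricalRow_le hM i m a y htpos hlpos).trans ?_
    rw [pathExp_add, pathExp_const_mul, pathExp_const_mul, pathExp_sum]
    simp only [pathExp_sq_transCount_sub hM, ← Finset.sum_mul]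
    refine add_le_add (mul_le_mul_of_nonneg_left ?_ (by positivity)) ?_
    · have h1 := pathExp_visitCount_le hM hg hG m a
      have h0 : 0 ≤ pathExp C.trans m a (visitCount i m a) :=
        Finset.sum_nonneg fun y _ => mul_nonneg
          (pathWeight_nonneg (fun _ _ => Matrix.nonneg_of_mem_rowStochastic hM) m a y)
          (pathAdd_nonneg (fun b c => by positivity) _ _ _)
      have h2 := sum_mul_one_sub_le (row_mem_stdSimplex hM i)
      have h3 : (0 : ℝ) ≤ 1 - 1 / (k : ℝ) := by
        have : (1 : ℝ) ≤ k := by exact_mod_cast (Fin.pos i)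
        rw [sub_nonneg, div_le_one (by linarith)]
        exact this
      refine mul_le_mul h2 (h1.trans_eq (by ring)) h0 h3
    · have h1 := pathExp_exp_neg_visitCount_le hM hg hG hlpos hlG1 m a
      calc 2 * Real.exp (l * t) * pathExp C.trans m a (fun y => Real.exp (-l * visitCount i m a y))
          ≤ 2 * Real.exp (l * t) *
            (Real.exp 2 * Real.exp (m * (-l * C.stat i + (l * (1 / δ)) ^ 2))) :=
            mul_le_mul_of_nonneg_left h1 (by positivity)
        _ = 2 * Real.exp 2 *
            Real.exp (l * t + m * (-l * C.stat i + (l * (1 / δ)) ^ 2)) := by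
            rw [Real.exp_add]; ring
        _ ≤ 2 * Real.exp 2 * Real.exp (-(ε ^ 2 * δ ^ 4 / 4) * m) := by
            refine mul_le_mul_of_nonneg_left (Real.exp_le_exp.2 ?_) (by positivity)
            rw [hlG, ht]
            have h2 : l * ε * δ ≤ l * ε * C.stat i :=
              mul_le_mul_of_nonneg_left hπ (mul_nonneg hlpos hε.le)
            have h3 : l * ε * δ = ε ^ 2 * δ ^ 4 / 2 := by rw [hl]; ring
            have h4 := mul_le_mul_of_nonneg_left (h3 ▸ h2) hm'.le
            nlinarith
  rw [stateRisk_empiricalEstimator]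
  calc _ ≤ ∑ a, C.init a * ((1 / t ^ 2) * ((1 - 1 / (k : ℝ)) * (m * C.stat i + 2 / δ)) +
        2 * Real.exp 2 * Real.exp (-(ε ^ 2 * δ ^ 4 / 4) * m)) :=
        Finset.sum_le_sum fun a _ => mul_le_mul_of_nonneg_left (hpt a) (C.init_mem.1 a)
    _ = _ := by rw [← Finset.sum_mul, C.init_mem.2, one_mul]

theorem tendsto_upper_factor (ε c d K : ℝ) (hε1 : ε < 1) (hc : 0 < c) :
    Tendsto (fun m : ℕ => ((m : ℝ) + 1) * (m + d) / ((1 - ε) * m) ^ 2 +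
      K * (((m : ℝ) + 1) * Real.exp (-c * m))) atTop (𝓝 (1 / (1 - ε) ^ 2)) := by
  have hcast := tendsto_natCast_atTop_atTop (R := ℝ)
  have hinv : Tendsto (fun m : ℕ => ((m : ℝ))⁻¹) atTop (𝓝 0) := tendsto_inv_atTop_zero.comp hcast
  have h1 : Tendsto (fun m : ℕ => ((m : ℝ) + 1) * (m + d) / ((1 - ε) * m) ^ 2) atTop
      (𝓝 (1 / (1 - ε) ^ 2)) := by
    have h : Tendsto (fun m : ℕ => (1 + ((m : ℝ))⁻¹) * (1 + d * ((m : ℝ))⁻¹) * (1 / (1 - ε) ^ 2))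
        atTop (𝓝 ((1 + 0) * (1 + d * 0) * (1 / (1 - ε) ^ 2))) :=
      ((tendsto_const_nhds.add hinv).mul
        (tendsto_const_nhds.add (tendsto_const_nhds.mul hinv))).mul tendsto_const_nhds
    simp only [add_zero, mul_zero, one_mul] at h
    refine h.congr' ?_
    filter_upwards [eventually_gt_atTop 0] with m hm
    have hm' : (m : ℝ) ≠ 0 := by exact_mod_cast hm.ne'
    have : 1 - ε ≠ 0 := by linarith
    field_simp
  have h2 : Tendsto (fun m : ℕ => ((m : ℝ) + 1) * Real.exp (-c * m)) atTop (𝓝 0) := by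
    have hcx : Tendsto (fun x : ℕ => c * (x : ℝ)) atTop atTop := hcast.const_mul_atTop hc
    have ha := (Real.tendsto_pow_mul_exp_neg_atTop_nhds_zero 1).comp hcx
    have hb := (Real.tendsto_pow_mul_exp_neg_atTop_nhds_zero 0).comp hcx
    have := (ha.const_mul c⁻¹).add hb
    simp only [add_zero, mul_zero] at this
    refine this.congr fun m => ?_
    simp only [Function.comp, pow_one, pow_zero, one_mul, neg_mul]
    field_simp
  simpa using h1.add (tendsto_const_nhds (x := K).mul h2)

/-- The risk of the empirical estimator at a state, uniformly over chains and states. -/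
theorem eventually_stateRisk_empiricalEstimator_le {k : ℕ} (hk : 2 ≤ k) {δ η : ℝ} (hδ : 0 < δ)
    (hη : 0 < η) : ∀ᶠ n : ℕ in atTop, ∀ C ∈ MarkovChain.lowerBounded k δ, ∀ i,
      stateRisk C (empiricalEstimator k n) i ≤
        (1 + η) * ((1 - 1 / (k : ℝ)) / (n * C.stat i)) := by
  have hk' : (2 : ℝ) ≤ k := by exact_mod_cast hk
  have hA : 0 < 1 - 1 / (k : ℝ) := by
    rw [sub_pos, div_lt_one (by linarith)]
    linarith
  set A := 1 - 1 / (k : ℝ) with hAdef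
  obtain ⟨ε, hε, hε1, hεη⟩ : ∃ ε : ℝ, 0 < ε ∧ ε < 1 ∧ 1 / (1 - ε) ^ 2 < 1 + η := by
    have hc : ContinuousAt (fun ε : ℝ => 1 / (1 - ε) ^ 2) 0 :=
      continuousAt_const.div (by fun_prop) (by norm_num)
    have h1 : ∀ᶠ ε in 𝓝 (0 : ℝ), 1 / (1 - ε) ^ 2 < 1 + η :=
      hc.eventually_lt continuousAt_const (by norm_num; exact hη)
    have h2 : ∀ᶠ ε in 𝓝 (0 : ℝ), ε < 1 := eventually_lt_nhds one_pos
    obtain ⟨ε, ⟨h3, h4⟩, h5⟩ := (((h1.and h2).filter_mono nhdsWithin_le_nhds).and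
      (self_mem_nhdsWithin (a := (0 : ℝ)) (s := Set.Ioi 0))).exists
    exact ⟨ε, h5, h4, h3⟩
  have hlim := tendsto_upper_factor ε (ε ^ 2 * δ ^ 4 / 4) (2 / δ ^ 2) (2 * Real.exp 2 / A) hε1
    (by positivity)
  have hev := (hlim.eventually (eventually_lt_nhds hεη)).and (eventually_gt_atTop 0)
  -- A sample of n = m + 1 states has `m` transitions.
  rw [← map_add_atTop_eq_nat 1, eventually_map]
  filter_upwards [hev] with m ⟨hm, hm0⟩ C hC i
  have hπ : δ ≤ C.stat i := C.le_stat fun a => hC a i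
  have hπ0 : 0 < C.stat i := hδ.trans_le hπ
  have hπ1 : C.stat i ≤ 1 := (mem_Icc_of_mem_stdSimplex C.stat_mem i).2
  have hm' : (0 : ℝ) < m := by exact_mod_cast hm0
  have h1ε : 0 < 1 - ε := by linarith
  set π := C.stat i with hπdef
  set q := Real.exp (-(ε ^ 2 * δ ^ 4 / 4) * m) with hq
  have hq0 : 0 < q := Real.exp_pos _
  refine (stateRisk_empiricalEstimator_le hδ hε hε1 hC i hm0).trans ?_
  rw [← hπdef, ← hAdef, ← hq]
  push_cast
  -- The target A / (nπ) is factored out of both terms; what remains is bounded uniformly in the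
  -- chain by δ ≤ π ≤ 1.
  have e1 : (1 / ((1 - ε) * m * π) ^ 2) * (A * (m * π + 2 / δ)) =
      A / ((m + 1) * π) * (((m : ℝ) + 1) * (m + 2 / (δ * π)) / ((1 - ε) * m) ^ 2) := by
    field_simp
  have e2 : 2 * Real.exp 2 * q =
      A / ((m + 1) * π) * (π * (2 * Real.exp 2 / A * (((m : ℝ) + 1) * q))) := by
    field_simp
  have h1 : 2 / (δ * π) ≤ 2 / δ ^ 2 := by
    rw [sq]
    gcongr
  have h2 : ((m : ℝ) + 1) * (m + 2 / (δ * π)) / ((1 - ε) * m) ^ 2 ≤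
      ((m : ℝ) + 1) * (m + 2 / δ ^ 2) / ((1 - ε) * m) ^ 2 := by
    gcongr
  have h3 : π * (2 * Real.exp 2 / A * (((m : ℝ) + 1) * q)) ≤
      2 * Real.exp 2 / A * (((m : ℝ) + 1) * q) :=
    mul_le_of_le_one_left (by positivity) hπ1
  rw [e1, e2, ← mul_add, mul_comm (1 + η)]
  refine mul_le_mul_of_nonneg_left ?_ (by positivity)
  linarith

/-! ### Asymptotic upper bounds. -/

theorem asympLE_of_forall_eventually {a b : ℕ → ℝ} (hb : ∀ᶠ n in atTop, 0 < b n)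
    (h : ∀ ε > 0, ∀ᶠ n in atTop, a n ≤ (1 + ε) * b n) : AsympLE a b := by
  -- The positive part is taken because the ratio a/b is only controlled from above.
  refine ⟨fun n => max (a n / b n - 1) 0, ?_, ?_⟩
  · rw [Metric.tendsto_nhds]
    intro ε hε
    filter_upwards [h (ε / 2) (by positivity), hb] with n hn hbn
    rw [Real.dist_0_eq_abs, abs_of_nonneg (le_max_right _ _)]
    refine max_lt ?_ hε
    have : a n / b n ≤ 1 + ε / 2 := by rwa [div_le_iff₀ hbn]
    linarith
  · filter_upwards [hb] with n hbn
    have h1 := le_max_left (a n / b n - 1) 0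
    have h2 : a n / b n ≤ 1 + max (a n / b n - 1) 0 := by linarith
    rwa [div_le_iff₀ hbn, mul_comm] at h2

theorem minimaxWeightedRisk_asympLE {k : ℕ} (hk : 2 ≤ k) {δ pmin : ℝ} (hδ : 0 < δ) :
    AsympLE (minimaxWeightedRisk (MarkovChain.lowerBoundedStat k δ pmin))
      (fun n => ((k : ℝ) - 1) / (n : ℝ)) := by
  have hk' : (2 : ℝ) ≤ k := by exact_mod_cast hk
  refine asympLE_of_forall_eventually ?_ fun ε hε => ?_
  · filter_upwards [eventually_gt_atTop 0] with n hn
    have : (0 : ℝ) < n := by exact_mod_cast hn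
    exact div_pos (by linarith) this
  filter_upwards [eventually_stateRisk_empiricalEstimator_le hk hδ hε, eventually_gt_atTop 0]
    with n hn hn0
  have hn' : (0 : ℝ) < n := by exact_mod_cast hn0
  have hbdd : BddBelow (Set.range fun E : TransitionEstimator k n =>
      ⨆ C : MarkovChain.lowerBoundedStat k δ pmin, weightedRisk C.1 E) :=
    ⟨0, by rintro _ ⟨E, rfl⟩; exact Real.iSup_nonneg fun C => weightedRisk_nonneg _ _⟩
  -- The second goal, nonnegativity of the bound, covers an empty class, whose supremum is 0 by
  -- convention.
  refine (ciInf_le hbdd (empiricalEstimator k n)).trans (Real.iSup_le (fun C => ?_) ?_)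
  · calc weightedRisk C.1 (empiricalEstimator k n)
        ≤ ∑ i, C.1.stat i * ((1 + ε) * ((1 - 1 / (k : ℝ)) / (n * C.1.stat i))) :=
          Finset.sum_le_sum fun i _ => mul_le_mul_of_nonneg_left (hn C.1 C.2.1 i)
            (C.1.stat_mem.1 i)
      _ = ∑ i : Fin k, (1 + ε) * ((1 - 1 / (k : ℝ)) / n) :=
          Finset.sum_congr rfl fun i _ => by
            have : 0 < C.1.stat i := hδ.trans_le (C.1.le_stat fun a => C.2.1 a i)
            field_simp
      _ = (1 + ε) * (((k : ℝ) - 1) / n) := by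
          rw [Finset.sum_const, Finset.card_univ, Fintype.card_fin, nsmul_eq_mul]
          field_simp
  · have : 0 ≤ ((k : ℝ) - 1) / n := div_nonneg (by linarith) hn'.le
    positivity

theorem minimaxWorstStateRisk_asympLE {k : ℕ} (hk : 2 ≤ k) {δ pmin : ℝ} (hδ : 0 < δ)
    (hp : 0 < pmin) :
    AsympLE (minimaxWorstStateRisk (MarkovChain.lowerBoundedStat k δ pmin))
      (fun n => (1 - 1 / (k : ℝ)) / ((n : ℝ) * pmin)) := by
  have hk' : (2 : ℝ) ≤ k := by exact_mod_cast hk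
  have hA : 0 < 1 - 1 / (k : ℝ) := by
    rw [sub_pos, div_lt_one (by linarith)]
    linarith
  refine asympLE_of_forall_eventually ?_ fun ε hε => ?_
  · filter_upwards [eventually_gt_atTop 0] with n hn
    have : (0 : ℝ) < n := by exact_mod_cast hn
    positivity
  filter_upwards [eventually_stateRisk_empiricalEstimator_le hk hδ hε, eventually_gt_atTop 0]
    with n hn hn0
  have hn' : (0 : ℝ) < n := by exact_mod_cast hn0
  have hbdd : BddBelow (Set.range fun E : TransitionEstimator k n =>
      ⨆ C : MarkovChain.lowerBoundedStat k δ pmin, worstStateRisk C.1 E) :=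
    ⟨0, by rintro _ ⟨E, rfl⟩; exact Real.iSup_nonneg fun C => worstStateRisk_nonneg _ _⟩
  refine (ciInf_le hbdd (empiricalEstimator k n)).trans (Real.iSup_le (fun C => ?_) ?_)
  · refine Real.iSup_le (fun i => (hn C.1 C.2.1 i).trans ?_) (by positivity)
    have : pmin ≤ C.1.stat i := C.2.2.2 ⟨i, rfl⟩
    gcongr
  · positivity

/-! ### Discrete van Trees inequality. -/

/-- A discrete van Trees inequality: a lower bound on the total squared error of an estimator of
the position on an arithmetic progression of length `L + 1`. -/
theorem sq_le_sum_sq_error_mul {X : Type*} [Fintype X] (L : ℕ) {p : ℕ → X → ℝ}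
    (hp : ∀ m ≤ L, ∀ x, 0 < p m x) (hsum : ∀ m ≤ L, ∑ x, p m x = 1) {χ : ℝ}
    (hχ : ∀ m < L, ∑ x, p (m + 1) x ^ 2 / p m x ≤ 1 + χ) (T : X → ℝ) (c s : ℝ) :
    (s * L) ^ 2 ≤
      (∑ m ∈ Finset.range (L + 1), ∑ x, p m x * (T x - (c + s * m)) ^ 2) * (2 + L * χ) := by
  set w : ℕ → ℝ := fun m => if 0 < m ∧ m ≤ L then 1 else 0 with hw
  have hw0 : w 0 = 0 := by simp [hw]
  have hwL : w (L + 1) = 0 := by simp [hw]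
  have hw1 : ∀ m < L, w (m + 1) = 1 := fun m hm => by
    simp only [hw]
    rw [if_pos ⟨Nat.succ_pos m, hm⟩]
  -- `ψ` plays the derivative of prior times likelihood. The weight vanishes at 0 and L + 1, so
  -- summation by parts has no boundary terms and each of the `L` weighted points contributes `s`.
  set ψ : ℕ → X → ℝ := fun m x => w (m + 1) * p (m + 1) x - w m * p m x with hψ
  have hparts : ∑ m ∈ Finset.range (L + 1), ∑ x, (T x - (c + s * m)) * ψ m x = s * L := by
    have h1 : ∀ m x, (T x - (c + s * m)) * ψ m x =
        ((T x - (c + s * ((m + 1 : ℕ) : ℝ))) * (w (m + 1) * p (m + 1) x) -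
          (T x - (c + s * m)) * (w m * p m x)) + s * (w (m + 1) * p (m + 1) x) := fun m x => by
      simp only [hψ]
      push_cast
      ring
    rw [Finset.sum_comm]
    simp only [h1, Finset.sum_add_distrib]
    have h2 : ∀ x, ∑ m ∈ Finset.range (L + 1),
        ((T x - (c + s * ((m + 1 : ℕ) : ℝ))) * (w (m + 1) * p (m + 1) x) -
          (T x - (c + s * m)) * (w m * p m x)) = 0 := fun x => by
      rw [Finset.sum_range_sub fun m : ℕ => (T x - (c + s * m)) * (w m * p m x)]
      simp [hw0, hwL]
    simp only [h2, Finset.sum_const_zero, zero_add]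
    rw [Finset.sum_comm]
    simp only [← Finset.mul_sum]
    congr 1
    rw [Finset.sum_range_succ, hwL, zero_mul, add_zero]
    rw [Finset.sum_congr rfl (g := fun _ => (1 : ℝ))]
    · simp
    · intro m hm
      have hm' := Finset.mem_range.1 hm
      rw [hw1 m hm', hsum (m + 1) hm', one_mul]
  -- The index 0 costs 1 + χ, each index strictly between 0 and `L` costs χ, and the index `L` at
  -- most 1.
  have hinfo : ∑ m ∈ Finset.range (L + 1), ∑ x, ψ m x ^ 2 / p m x ≤ 2 + L * χ := by
    have h1 : ∀ m < L, ∑ x, ψ m x ^ 2 / p m x ≤ χ + if m = 0 then 1 else 0 := by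
      intro m hm
      have e : ∀ x, ψ m x ^ 2 / p m x =
          p (m + 1) x ^ 2 / p m x - 2 * w m * p (m + 1) x + w m ^ 2 * p m x := fun x => by
        have := (hp m hm.le x).ne'
        simp only [hψ, hw1 m hm]
        field_simp
        ring
      simp only [e, Finset.sum_add_distrib, Finset.sum_sub_distrib, ← Finset.mul_sum,
        hsum m hm.le, hsum (m + 1) hm]
      have h2 := hχ m hm
      rcases Nat.eq_zero_or_pos m with h0 | h0
      · subst h0
        simp only [hw0, if_true]
        linarith
      · have : w m = 1 := by
          simp only [hw]
          rw [if_pos ⟨h0, hm.le⟩]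
        rw [this, if_neg h0.ne']
        linarith
    have h2 : ∑ x, ψ L x ^ 2 / p L x ≤ 1 := by
      have e : ∀ x, ψ L x ^ 2 / p L x = w L ^ 2 * p L x := fun x => by
        have := (hp L le_rfl x).ne'
        simp only [hψ, hwL]
        field_simp
        ring
      simp only [e, ← Finset.mul_sum, hsum L le_rfl, mul_one, hw]
      split_ifs <;> norm_num
    rw [Finset.sum_range_succ]
    have h3 : ∑ m ∈ Finset.range L, ∑ x, ψ m x ^ 2 / p m x ≤
        ∑ m ∈ Finset.range L, (χ + if m = 0 then 1 else 0) :=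
      Finset.sum_le_sum fun m hm => h1 m (Finset.mem_range.1 hm)
    rw [Finset.sum_add_distrib, Finset.sum_ite_eq'] at h3
    simp only [Finset.sum_const, Finset.card_range, nsmul_eq_mul] at h3
    have h4 : (if 0 ∈ Finset.range L then (1 : ℝ) else 0) ≤ 1 := by split_ifs <;> norm_num
    linarith
  have hcs : (∑ m ∈ Finset.range (L + 1), ∑ x, (T x - (c + s * m)) * ψ m x) ^ 2 ≤
      (∑ m ∈ Finset.range (L + 1), ∑ x, p m x * (T x - (c + s * m)) ^ 2) *
        ∑ m ∈ Finset.range (L + 1), ∑ x, ψ m x ^ 2 / p m x := by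
    simp only [← Finset.sum_product']
    refine Finset.sum_sq_le_sum_mul_sum_of_sq_le_mul _ (fun q hq => ?_) (fun q hq => ?_)
      fun q hq => ?_
    all_goals
      have hq1 : q.1 ≤ L := Nat.lt_succ_iff.1 (Finset.mem_range.1 (Finset.mem_product.1 hq).1)
      have := hp q.1 hq1 q.2
    · positivity
    · positivity
    · refine le_of_eq ?_
      field_simp
  rw [hparts] at hcs
  refine hcs.trans (mul_le_mul_of_nonneg_left hinfo ?_)
  refine Finset.sum_nonneg fun m hm => Finset.sum_nonneg fun x _ => ?_
  have := hp m (Nat.lt_succ_iff.1 (Finset.mem_range.1 hm)) x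
  positivity

/-- Swapping `b` with the coordinate θ_l is an involution of the pairs (θ, b). This lets the
one-dimensional inequality be averaged over all lines of the grid in direction `l`. -/
theorem sum_sum_update {ι β : Type*} [Fintype ι] [DecidableEq ι] [Fintype β] (l : ι)
    (F : (ι → β) → ℝ) :
    ∑ θ : ι → β, ∑ b, F (Function.update θ l b) = Fintype.card β * ∑ θ, F θ := by
  have hinv : Function.Involutive fun q : (ι → β) × β => (Function.update q.1 l q.2, q.1 l) := by
    rintro ⟨θ, b⟩
    simp
  rw [← Fintype.sum_prod_type']
  have := Fintype.sum_equiv hinv.toPerm (fun q : (ι → β) × β => F (Function.update q.1 l q.2))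
    (fun q => F q.1) fun q => rfl
  rw [this, Fintype.sum_prod_type]
  simp only [Finset.sum_const, Finset.card_univ, nsmul_eq_mul, Finset.mul_sum]

/-- The discrete van Trees inequality for one coordinate of a multidimensional grid. -/
theorem card_mul_sq_le_sum_sq_error_mul {X ι : Type*} [Fintype X] [Fintype ι] [DecidableEq ι]
    (L : ℕ) {p : (ι → Fin (L + 1)) → X → ℝ} (hp : ∀ θ x, 0 < p θ x) (hsum : ∀ θ, ∑ x, p θ x = 1)
    {χ : ℝ} (hχ0 : 0 ≤ χ) (l : ι)
    (hχ : ∀ θ θ', (∀ l' ≠ l, θ' l' = θ l') → (θ' l : ℕ) = θ l + 1 →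
      ∑ x, p θ' x ^ 2 / p θ x ≤ 1 + χ) (T : X → ℝ) (c s : ℝ) :
    Fintype.card (ι → Fin (L + 1)) * ((s * L) ^ 2 / ((L + 1) * (2 + L * χ))) ≤
      ∑ θ, ∑ x, p θ x * (T x - (c + s * (θ l : ℕ))) ^ 2 := by
  have h1 : ∀ θ, (s * L) ^ 2 ≤ (∑ b : Fin (L + 1), ∑ x, p (Function.update θ l b) x *
      (T x - (c + s * (Function.update θ l b l : ℕ))) ^ 2) * (2 + L * χ) := by
    intro θ
    have h := sq_le_sum_sq_error_mul L (p := fun m => p (Function.update θ l (Fin.ofNat (L + 1) m)))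
      (fun m _ x => hp _ x) (fun m _ => hsum _) (χ := χ) (fun m hm => by
        refine hχ _ _ (fun l' hl' => by simp [hl']) ?_
        rw [Function.update_self, Function.update_self, Fin.val_ofNat, Fin.val_ofNat,
          Nat.mod_eq_of_lt (by omega), Nat.mod_eq_of_lt (by omega)]) T c s
    rw [Finset.sum_range] at h
    simpa only [Fin.ofNat_val_eq_self, Function.update_self] using h
  have h2 := Finset.sum_le_sum fun θ (_ : θ ∈ Finset.univ) => h1 θ
  rw [← Finset.sum_mul, sum_sum_update l fun θ => ∑ x, p θ x * (T x - (c + s * (θ l : ℕ))) ^ 2,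
    Finset.sum_const, Finset.card_univ, nsmul_eq_mul, Fintype.card_fin] at h2
  rw [← mul_div_assoc, div_le_iff₀ (by positivity)]
  push_cast at h2
  linarith

/-! ### Chi-square divergence of path laws and the limiting constant. -/

/-- The chi-square divergence between the path distributions of two nearby chains. -/
theorem sum_sq_pathProb_div_le {k m : ℕ} {C C' : MarkovChain k} {c : Fin k → ℝ}
    (hc : ∀ j, 0 < c j) (hc1 : ∑ j, c j = 1) (hC : C.init = c) (hC' : C'.init = c) {B : ℝ}
    (hB : 1 ≤ B) (h1 : ∀ i j, c j ≤ B * C.trans i j) (h2 : ∀ i j, C'.trans i j ≤ B * c j) :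
    ∑ x, C'.pathProb (m + 1) x ^ 2 / C.pathProb (m + 1) x ≤
      Real.exp ((m + 1) * (B ^ 4 * ∑ i, c i * ∑ j, (C'.trans i j - C.trans i j) ^ 2 / c j)) := by
  set I := ∑ i, c i * ∑ j, (C'.trans i j - C.trans i j) ^ 2 / c j with hI
  clear_value I
  have hI0 : 0 ≤ I := hI ▸ Finset.sum_nonneg fun i _ => mul_nonneg (hc i).le
    (Finset.sum_nonneg fun j _ => div_nonneg (sq_nonneg _) (hc j).le)
  have hB0 : 0 < B := by linarith
  have hMpos : ∀ i j, 0 < C.trans i j := fun i j => by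
    have := h1 i j
    have := hc j
    by_contra hn
    push Not at hn
    nlinarith
  have hM'0 : ∀ i j, 0 ≤ C'.trans i j := fun i j => Matrix.nonneg_of_mem_rowStochastic C'.trans_mem
  have hinv : ∀ i j, 1 / C.trans i j ≤ B / c j := fun i j => by
    rw [div_le_div_iff₀ (hMpos i j) (hc j)]
    linarith [h1 i j]
  set W : Matrix (Fin k) (Fin k) ℝ := fun i j => C'.trans i j ^ 2 / C.trans i j with hW
  have hW0 : ∀ i j, 0 ≤ W i j := fun i j => div_nonneg (sq_nonneg _) (hMpos i j).le
  -- Each step of `W` nearly forgets its starting state, so the row divergences `u` get averaged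
  -- against `c`; this produces `I` in place of the maximum of `u`.
  have hWle : ∀ i j, W i j ≤ B ^ 3 * c j := fun i j => by
    calc W i j = C'.trans i j ^ 2 * (1 / C.trans i j) := by simp only [hW]; ring
      _ ≤ (B * c j) ^ 2 * (B / c j) := by
          exact mul_le_mul (pow_le_pow_left₀ (hM'0 i j) (h2 i j) 2) (hinv i j)
            (div_nonneg zero_le_one (hMpos i j).le) (by positivity)
      _ = B ^ 3 * c j := by
          have := (hc j).ne'
          field_simp
  set u : Fin k → ℝ := fun i => ∑ j, (C'.trans i j - C.trans i j) ^ 2 / C.trans i j with hu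
  have hu0 : ∀ i, 0 ≤ u i := fun i => Finset.sum_nonneg fun j _ =>
    div_nonneg (sq_nonneg _) (hMpos i j).le
  have hule : ∀ i, u i ≤ B * ∑ j, (C'.trans i j - C.trans i j) ^ 2 / c j := fun i => by
    rw [Finset.mul_sum]
    refine Finset.sum_le_sum fun j _ => ?_
    have := mul_le_mul_of_nonneg_left (hinv i j) (sq_nonneg (C'.trans i j - C.trans i j))
    calc _ = (C'.trans i j - C.trans i j) ^ 2 * (1 / C.trans i j) := by ring
      _ ≤ _ := this
      _ = _ := by ring
  have hrow : ∀ i, ∑ j, W i j = 1 + u i := fun i => by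
    have e : ∀ j, W i j = (2 * C'.trans i j - C.trans i j) +
        (C'.trans i j - C.trans i j) ^ 2 / C.trans i j := fun j => by
      have := (hMpos i j).ne'
      simp only [hW]
      field_simp
      ring
    simp only [e, Finset.sum_add_distrib, Finset.sum_sub_distrib, ← Finset.mul_sum,
      Matrix.sum_row_of_mem_rowStochastic C.trans_mem,
      Matrix.sum_row_of_mem_rowStochastic C'.trans_mem]
    simp only [hu]
    ring
  have hWu : ∀ i, ∑ j, W i j * u j ≤ B ^ 4 * I := fun i => by
    rw [hI, Finset.mul_sum]
    refine Finset.sum_le_sum fun j _ => ?_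
    calc W i j * u j ≤ (B ^ 3 * c j) * (B * ∑ j', (C'.trans j j' - C.trans j j') ^ 2 / c j') :=
          mul_le_mul (hWle i j) (hule j) (hu0 j) (mul_nonneg (by positivity) (hc j).le)
      _ = _ := by ring
  -- The rows of `W` sum to 1 + u, and one further step adds at most B⁴I: hence 1 + u is a
  -- supersolution with factor 1 + B⁴I.
  have hpow := pathExp_one_le_pow (f := fun i => 1 + u i) (ρ := 1 + B ^ 4 * I) hW0 (by positivity)
    (fun a => by linarith [hu0 a]) (fun a => by
      simp only [mul_add, mul_one, Finset.sum_add_distrib, hrow]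
      have := hWu a
      nlinarith [mul_nonneg (by positivity : 0 ≤ B ^ 4 * I) (hu0 a)]) m
  have hcu : ∑ a, c a * (1 + u a) ≤ 1 + B ^ 4 * I := by
    have h3 : ∑ a, c a * u a ≤ B * I := by
      rw [hI, Finset.mul_sum]
      refine Finset.sum_le_sum fun a _ => ?_
      have := mul_le_mul_of_nonneg_left (hule a) (hc a).le
      linarith
    have h4 : B * I ≤ B ^ 4 * I :=
      mul_le_mul_of_nonneg_right (le_self_pow₀ hB (by norm_num)) hI0
    simp only [mul_add, mul_one, Finset.sum_add_distrib, hc1]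
    linarith
  calc ∑ x, C'.pathProb (m + 1) x ^ 2 / C.pathProb (m + 1) x
      = ∑ a, c a * pathExp W m a (fun _ => 1) := by
        rw [sum_pi_fin_succ]
        refine Finset.sum_congr rfl fun a _ => ?_
        rw [pathExp, Finset.mul_sum]
        refine Finset.sum_congr rfl fun y _ => ?_
        rw [pathProb_cons, pathProb_cons, hC, hC', hW, ← pathWeight_sq_div, mul_one, mul_pow,
          mul_div_mul_comm]
        have := (hc a).ne'
        congr 1
        field_simp
    _ ≤ ∑ a, c a * ((1 + B ^ 4 * I) ^ m * (1 + u a)) :=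
        Finset.sum_le_sum fun a _ => mul_le_mul_of_nonneg_left (hpow a) (hc a).le
    _ = (1 + B ^ 4 * I) ^ m * ∑ a, c a * (1 + u a) := by
        rw [Finset.mul_sum]; exact Finset.sum_congr rfl fun _ _ => by ring
    _ ≤ (1 + B ^ 4 * I) ^ m * (1 + B ^ 4 * I) := by gcongr
    _ = (1 + B ^ 4 * I) ^ (m + 1) := by ring
    _ ≤ Real.exp (B ^ 4 * I) ^ (m + 1) := by
        gcongr
        linarith [Real.add_one_le_exp (B ^ 4 * I)]
    _ = Real.exp ((m + 1) * (B ^ 4 * I)) := by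
        rw [← Real.exp_nat_mul]
        push_cast
        rfl

theorem MarkovChain.pathProb_pos {k : ℕ} {C : MarkovChain k} (hi : ∀ j, 0 < C.init j)
    (ht : ∀ i j, 0 < C.trans i j) (n : ℕ) (x : Fin n → Fin k) : 0 < C.pathProb n x := by
  cases n with
  | zero => simp [MarkovChain.pathProb]
  | succ m => exact mul_pos (hi _) (Finset.prod_pos fun _ _ => ht _ _)

/-- As L → ∞ the right side tends to a² / (exp(a²I) - 1), which tends to 1/I > κ as a → 0. The order
matters: `a` is fixed before `L`. -/
theorem eventually_le_vanTrees_bound {I κ : ℝ} (hI : 0 < I) (hκ : 0 < κ) (hκI : κ * I < 1) :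
    ∀ᶠ a in 𝓝[>] (0 : ℝ), ∀ᶠ L : ℕ in atTop,
      κ ≤ a ^ 2 * (L : ℝ) ^ 2 / ((L + 1) * (2 + L * (Real.exp (a ^ 2 * I) - 1))) := by
  have h1 : ∀ᶠ a in 𝓝 (0 : ℝ), κ * I * (1 + a ^ 2 * I) < 1 :=
    ContinuousAt.eventually_lt (by fun_prop) continuousAt_const (by simpa using hκI)
  have h2 : ∀ᶠ a in 𝓝 (0 : ℝ), a ^ 2 * I < 1 :=
    ContinuousAt.eventually_lt (by fun_prop) continuousAt_const (by simp)
  filter_upwards [h1.filter_mono nhdsWithin_le_nhds, h2.filter_mono nhdsWithin_le_nhds,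
    self_mem_nhdsWithin] with a ha1 ha2 ha
  have ha0 : 0 < a := ha
  set E := Real.exp (a ^ 2 * I) - 1 with hE
  have hE0 : 0 < E := by
    have := Real.add_one_le_exp (a ^ 2 * I)
    have : 0 < a ^ 2 * I := by positivity
    linarith
  have hEle : E ≤ a ^ 2 * I + (a ^ 2 * I) ^ 2 := by
    have := le_of_abs_le (Real.abs_exp_sub_one_sub_id_le (x := a ^ 2 * I)
      (by rw [abs_of_nonneg (by positivity)]; exact ha2.le))
    linarith
  have hlt : κ * E < a ^ 2 := by
    calc κ * E ≤ κ * (a ^ 2 * I + (a ^ 2 * I) ^ 2) := by gcongr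
      _ = a ^ 2 * (κ * I * (1 + a ^ 2 * I)) := by ring
      _ < a ^ 2 * 1 := by gcongr
      _ = a ^ 2 := mul_one _
  have hinv : Tendsto (fun L : ℕ => ((L : ℝ))⁻¹) atTop (𝓝 0) :=
    tendsto_inv_atTop_zero.comp tendsto_natCast_atTop_atTop
  have hlim : Tendsto (fun L : ℕ => κ * ((1 + ((L : ℝ))⁻¹) * (2 * ((L : ℝ))⁻¹ + E))) atTop
      (𝓝 (κ * ((1 + 0) * (2 * 0 + E)))) :=
    tendsto_const_nhds.mul ((tendsto_const_nhds.add hinv).mul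
      ((tendsto_const_nhds.mul hinv).add tendsto_const_nhds))
  have hev := hlim.eventually (eventually_lt_nhds (b := a ^ 2) (by simpa using hlt))
  filter_upwards [hev, eventually_gt_atTop 0] with L hL hL0
  have hL' : (0 : ℝ) < L := by exact_mod_cast hL0
  rw [le_div_iff₀ (by positivity)]
  have h3 := mul_le_mul_of_nonneg_right hL.le (sq_nonneg (L : ℝ))
  refine le_trans (le_of_eq ?_) h3
  field_simp

/-! ### Stationary distributions and orthonormal directions. -/

/-- M - 1 kills the constants, so it has a left null vector v. The triangle inequality gives |v| ≤
|v|M entrywise with equal totals, so |v| is invariant. -/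
theorem exists_stationary {k : ℕ} (hk : 0 < k) {M : Matrix (Fin k) (Fin k) ℝ}
    (hM : M ∈ Matrix.rowStochastic ℝ (Fin k)) :
    ∃ p ∈ stdSimplex ℝ (Fin k), Matrix.vecMul p M = p := by
  have hdet : (M - 1).det = 0 := by
    rw [← Matrix.exists_mulVec_eq_zero_iff]
    refine ⟨1, fun h => ?_, ?_⟩
    · exact one_ne_zero (congrFun h ⟨0, hk⟩)
    · rw [Matrix.sub_mulVec, Matrix.one_vecMul_of_mem_rowStochastic hM, Matrix.one_mulVec, sub_self]
  obtain ⟨v, hv0, hv⟩ := Matrix.exists_vecMul_eq_zero_iff.2 hdet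
  rw [Matrix.vecMul_sub, Matrix.vecMul_one, sub_eq_zero] at hv
  have hvj : ∀ j, ∑ i, v i * M i j = v j := fun j => congrFun hv j
  have hM0 : ∀ i j, 0 ≤ M i j := fun i j => Matrix.nonneg_of_mem_rowStochastic hM
  have hle : ∀ j, |v j| ≤ ∑ i, |v i| * M i j := fun j => by
    conv_lhs => rw [← hvj j]
    refine (Finset.abs_sum_le_sum_abs _ _).trans (Finset.sum_le_sum fun i _ => ?_)
    rw [abs_mul, abs_of_nonneg (hM0 i j)]
  have htot : ∑ j, ∑ i, |v i| * M i j = ∑ j, |v j| := by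
    rw [Finset.sum_comm]
    simp only [← Finset.mul_sum, Matrix.sum_row_of_mem_rowStochastic hM, mul_one]
  have heq := (Finset.sum_eq_sum_iff_of_le fun j (_ : j ∈ Finset.univ) => hle j).1 htot.symm
  have hpos : 0 < ∑ j, |v j| := by
    obtain ⟨j, hj⟩ := Function.ne_iff.1 hv0
    exact Finset.sum_pos' (fun _ _ => abs_nonneg _) ⟨j, Finset.mem_univ j, abs_pos.2 hj⟩
  refine ⟨fun j => |v j| / ∑ j, |v j|, ⟨fun j => by positivity, ?_⟩, ?_⟩
  · rw [← Finset.sum_div, div_self hpos.ne']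
  · funext j
    simp only [Matrix.vecMul, dotProduct, div_mul_eq_mul_div, ← Finset.sum_div]
    rw [← heq j (Finset.mem_univ j)]

/-- Bessel's inequality, from expanding the squared distance of `e` to its projection. -/
theorem sum_sq_inner_le {ι J : Type*} [Fintype ι] [DecidableEq ι] [Fintype J] {V : ι → J → ℝ}
    (hV : ∀ l l', ∑ j, V l j * V l' j = if l = l' then 1 else 0) (e : J → ℝ) :
    ∑ l, (∑ j, e j * V l j) ^ 2 ≤ ∑ j, e j ^ 2 := by
  set b : ι → ℝ := fun l => ∑ j, e j * V l j with hb
  have h1 : ∑ j, e j * ∑ l, b l * V l j = ∑ l, b l ^ 2 := by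
    simp only [Finset.mul_sum]
    rw [Finset.sum_comm]
    refine Finset.sum_congr rfl fun l _ => ?_
    rw [sq]
    conv_rhs => rw [hb]
    simp only [Finset.mul_sum]
    exact Finset.sum_congr rfl fun j _ => by ring
  have h2 : ∑ j, (∑ l, b l * V l j) ^ 2 = ∑ l, b l ^ 2 := by
    simp only [sq, Finset.sum_mul_sum]
    rw [Finset.sum_comm]
    refine Finset.sum_congr rfl fun l _ => ?_
    rw [Finset.sum_comm]
    have : ∀ l', ∑ j, b l * V l j * (b l' * V l' j) = if l = l' then b l * b l' else 0 :=
      fun l' => by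
        have : ∀ j, b l * V l j * (b l' * V l' j) = (b l * b l') * (V l j * V l' j) :=
          fun j => by ring
        simp only [this, ← Finset.mul_sum, hV, mul_ite, mul_one, mul_zero]
    simp [this]
  have h3 : 0 ≤ ∑ j, (e j - ∑ l, b l * V l j) ^ 2 := Finset.sum_nonneg fun _ _ => sq_nonneg _
  have e3 : ∀ j, (e j - ∑ l, b l * V l j) ^ 2 =
      e j ^ 2 - 2 * (e j * ∑ l, b l * V l j) + (∑ l, b l * V l j) ^ 2 := fun j => by ring
  simp only [e3, Finset.sum_add_distrib, Finset.sum_sub_distrib, ← Finset.mul_sum, h1, h2] at h3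
  linarith

theorem exists_orthonormal_perp {k d r : ℕ} (hd : d + r ≤ k) (w : Fin r → Fin k → ℝ) :
    ∃ v : Fin d → Fin k → ℝ, (∀ l l', ∑ j, v l j * v l' j = if l = l' then 1 else 0) ∧
      ∀ l t, ∑ j, w t j * v l j = 0 := by
  set S : Submodule ℝ (EuclideanSpace ℝ (Fin k)) :=
    Submodule.span ℝ (Set.range fun t => WithLp.toLp 2 (w t)) with hS
  have hS1 : Module.finrank ℝ S ≤ r := by
    have := finrank_range_le_card (R := ℝ) fun t : Fin r => WithLp.toLp 2 (w t)
    simpa [Set.finrank] using this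
  have hS2 := S.finrank_add_finrank_orthogonal
  rw [finrank_euclideanSpace_fin] at hS2
  have hle : d ≤ Module.finrank ℝ Sᗮ := by omega
  set b := stdOrthonormalBasis ℝ Sᗮ
  refine ⟨fun l j => (b (Fin.castLE hle l) : EuclideanSpace ℝ (Fin k)) j, fun l l' => ?_,
    fun l t => ?_⟩
  · have h := orthonormal_iff_ite.1 b.orthonormal (Fin.castLE hle l) (Fin.castLE hle l')
    rw [Submodule.coe_inner, PiLp.inner_apply] at h
    simp only [RCLike.inner_apply, conj_trivial, (Fin.castLE_injective hle).eq_iff] at h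
    rw [← h]
    exact Finset.sum_congr rfl fun j _ => mul_comm _ _
  · have h := Submodule.inner_right_of_mem_orthogonal (K := S)
      (Submodule.subset_span (Set.mem_range_self t)) (b (Fin.castLE hle l)).2
    rw [PiLp.inner_apply] at h
    simp only [RCLike.inner_apply, conj_trivial] at h
    rw [← h]
    exact Finset.sum_congr rfl fun j _ => mul_comm _ _

/-! ### Local perturbations of a chain with independent states. -/

/-- Around a chain with independent states there are local perturbations, along finitely many
orthonormal directions, on which no estimator beats the Cramér-Rao bound asymptotically. -/
theorem exists_perturbation_family {k : ℕ} (hk : 0 < k) {ι : Type*} [Fintype ι] [DecidableEq ι]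
    {c : Fin k → ℝ} (hc : ∀ j, 0 < c j) (hc1 : ∑ j, c j = 1) {V : ι → Fin k → Fin k → ℝ}
    (hrow : ∀ l i, ∑ j, V l i j = 0)
    (horth : ∀ l l', ∑ i, ∑ j, V l i j * V l' i j = if l = l' then 1 else 0)
    {I κ : ι → ℝ} (hI : ∀ l, ∑ i, c i * ∑ j, V l i j ^ 2 / c j = I l) (hI0 : ∀ l, 0 < I l)
    (hκ : ∀ l, 0 < κ l) (hκI : ∀ l, κ l * I l < 1) {ρ : ℝ} (hρ : 0 < ρ) :
    ∃ L : ℕ, ∀ᶠ n : ℕ in atTop, ∃ C : (ι → Fin (L + 1)) → MarkovChain k,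
      (∃ s : ℝ, ∀ θ i j, (C θ).trans i j = c j + s * ∑ l, ((θ l : ℕ) : ℝ) * V l i j) ∧
      (∀ θ i j, |(C θ).trans i j - c j| ≤ ρ) ∧
      ∀ (E : TransitionEstimator k n) (l : ι),
        Fintype.card (ι → Fin (L + 1)) * (κ l / n) ≤ ∑ θ, ∑ x, (C θ).pathProb n x *
          (∑ i, ∑ j, ((C θ).trans i j - (E x : Matrix (Fin k) (Fin k) ℝ) i j) * V l i j) ^ 2 := by
  obtain ⟨B, hBκ, hB⟩ : ∃ B : ℝ, (∀ l, κ l * (B ^ 4 * I l) < 1) ∧ 1 < B := by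
    have h1 : ∀ᶠ B in 𝓝 (1 : ℝ), ∀ l, κ l * (B ^ 4 * I l) < 1 :=
      eventually_all.2 fun l => ContinuousAt.eventually_lt (by fun_prop) continuousAt_const
        (by simpa using hκI l)
    exact ((h1.filter_mono nhdsWithin_le_nhds).and self_mem_nhdsWithin).exists (f := 𝓝[>] (1 : ℝ))
  obtain ⟨a, haL, ha⟩ := ((eventually_all.2 fun l => eventually_le_vanTrees_bound
    (I := B ^ 4 * I l) (mul_pos (by positivity) (hI0 l)) (hκ l) (hBκ l)).and
    self_mem_nhdsWithin).exists
  have ha0 : 0 < a := ha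
  obtain ⟨L, hL⟩ := (eventually_all.2 haL).exists
  obtain ⟨c₀, hc₀, hcc⟩ : ∃ c₀ : ℝ, 0 < c₀ ∧ ∀ j, c₀ ≤ c j := by
    have : Nonempty (Fin k) := ⟨⟨0, hk⟩⟩
    obtain ⟨j, hj⟩ := Finite.exists_min c
    exact ⟨c j, hc j, hj⟩
  have hB0 : 0 < B := by linarith
  have hBinv : 0 < 1 - 1 / B := by
    rw [sub_pos, div_lt_one hB0]
    exact hB
  set r := min ρ ((1 - 1 / B) * c₀) with hr
  have hr0 : 0 < r := lt_min hρ (mul_pos hBinv hc₀)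
  set K : ℝ := ∑ l, ∑ i, ∑ j, L * |V l i j| with hK
  have hKle : ∀ (θ : ι → Fin (L + 1)) i j, |∑ l, ((θ l : ℕ) : ℝ) * V l i j| ≤ K := by
    intro θ i j
    refine (Finset.abs_sum_le_sum_abs _ _).trans (Finset.sum_le_sum fun l _ => ?_)
    have h0 : ∀ i j, 0 ≤ (L : ℝ) * |V l i j| := fun i j => by positivity
    calc |((θ l : ℕ) : ℝ) * V l i j| = ((θ l : ℕ) : ℝ) * |V l i j| := by
          rw [abs_mul, abs_of_nonneg (Nat.cast_nonneg _)]
      _ ≤ L * |V l i j| := by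
          gcongr
          exact Nat.lt_succ_iff.1 (θ l).2
      _ ≤ ∑ j, L * |V l i j| := Finset.single_le_sum (fun j _ => h0 i j) (Finset.mem_univ j)
      _ ≤ ∑ i, ∑ j, L * |V l i j| := Finset.single_le_sum
          (f := fun i => ∑ j, L * |V l i j|)
          (fun i _ => Finset.sum_nonneg fun j _ => h0 i j) (Finset.mem_univ i)
  have hsmall : ∀ᶠ n : ℕ in atTop, a / √(n : ℝ) * K < r := by
    have h1 : Tendsto (fun n : ℕ => a / √(n : ℝ) * K) atTop (𝓝 (0 * K)) :=
      (Tendsto.div_atTop tendsto_const_nhds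
        (Real.tendsto_sqrt_atTop.comp tendsto_natCast_atTop_atTop)).mul_const K
    exact h1.eventually (eventually_lt_nhds (by simpa using hr0))
  refine ⟨L, ?_⟩
  filter_upwards [hsmall, eventually_gt_atTop 0] with n hn hn0
  obtain ⟨m, rfl⟩ : ∃ m, n = m + 1 := ⟨n - 1, by omega⟩
  have hn' : (0 : ℝ) < ((m + 1 : ℕ) : ℝ) := by exact_mod_cast hn0
  -- At mesh a/√n the chi-square bound between neighbours, exp(n s² B⁴ I) - 1, does not depend on
  -- `n`.
  set s : ℝ := a / √((m + 1 : ℕ) : ℝ) with hs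
  have hs0 : 0 < s := div_pos ha0 (Real.sqrt_pos.2 hn')
  have hs2 : ((m + 1 : ℕ) : ℝ) * s ^ 2 = a ^ 2 := by
    rw [hs, div_pow, Real.sq_sqrt hn'.le]
    field_simp
  set M : (ι → Fin (L + 1)) → Matrix (Fin k) (Fin k) ℝ :=
    fun θ i j => c j + s * ∑ l, ((θ l : ℕ) : ℝ) * V l i j with hM
  have hMr : ∀ θ i j, |M θ i j - c j| ≤ r := fun θ i j => by
    simp only [hM, add_sub_cancel_left, abs_mul, abs_of_pos hs0]
    exact (mul_le_mul_of_nonneg_left (hKle θ i j) hs0.le).trans hn.le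
  have hMr' : ∀ θ i j, |M θ i j - c j| ≤ (1 - 1 / B) * c j := fun θ i j =>
    (hMr θ i j).trans ((min_le_right _ _).trans (mul_le_mul_of_nonneg_left (hcc j) hBinv.le))
  have hlow : ∀ θ i j, c j ≤ B * M θ i j := fun θ i j => by
    have h := neg_le_of_abs_le (hMr' θ i j)
    have h1 : 1 / B * c j ≤ M θ i j := by linarith
    have h2 := mul_le_mul_of_nonneg_left h1 hB0.le
    have e : B * (1 / B * c j) = c j := by field_simp
    linarith
  have hupp : ∀ θ i j, M θ i j ≤ B * c j := fun θ i j => by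
    have h := le_of_abs_le (hMr' θ i j)
    -- The radius (1 - 1/B) c_j was chosen for the lower bound c_j / B; it yields the upper bound B
    -- c_j because B + 1/B ≥ 2.
    have h1 : 2 - 1 / B ≤ B := by
      have e : B - (2 - 1 / B) = (B - 1) ^ 2 / B := by field_simp; ring
      have : 0 ≤ (B - 1) ^ 2 / B := by positivity
      linarith
    have := mul_le_mul_of_nonneg_right h1 (hc j).le
    linarith
  have hMpos : ∀ θ i j, 0 < M θ i j := fun θ i j => by
    have := hlow θ i j
    have := hc j
    by_contra hneg
    push Not at hneg
    nlinarith
  have hMsto : ∀ θ, M θ ∈ Matrix.rowStochastic ℝ (Fin k) := fun θ =>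
    Matrix.mem_rowStochastic_iff_sum.2 ⟨fun i j => (hMpos θ i j).le, fun i => by
      simp only [hM, Finset.sum_add_distrib, hc1, ← Finset.mul_sum]
      rw [Finset.sum_comm]
      simp only [← Finset.mul_sum, hrow, mul_zero, Finset.sum_const_zero, add_zero]⟩
  choose st hst hstM using fun θ => exists_stationary hk (hMsto θ)
  set C : (ι → Fin (L + 1)) → MarkovChain k := fun θ =>
    ⟨c, M θ, st θ, ⟨fun j => (hc j).le, hc1⟩, hMsto θ, hst θ, hstM θ⟩ with hC
  refine ⟨C, ⟨s, fun θ i j => rfl⟩, fun θ i j => (hMr θ i j).trans (min_le_left _ _),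
    fun E l => ?_⟩
  have hχ0 : 0 ≤ Real.exp (a ^ 2 * (B ^ 4 * I l)) - 1 := by
    rw [sub_nonneg]
    exact Real.one_le_exp (mul_nonneg (sq_nonneg a) (mul_nonneg (by positivity) (hI0 l).le))
  have hvT := card_mul_sq_le_sum_sq_error_mul L (p := fun θ x => (C θ).pathProb (m + 1) x)
    (fun θ x => MarkovChain.pathProb_pos (C := C θ) hc (hMpos θ) _ x) (fun θ => sum_pathProb _ _)
    hχ0 l (fun θ θ' hne heq => by
      refine (sum_sq_pathProb_div_le (C := C θ) (C' := C θ') hc hc1 rfl rfl hB.le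
        (hlow θ) (hupp θ')).trans (le_of_eq ?_)
      have hD : ∀ i j, (C θ').trans i j - (C θ).trans i j = s * V l i j := fun i j => by
        simp only [hC, hM]
        have : ∑ l', ((θ' l' : ℕ) : ℝ) * V l' i j =
            ∑ l', ((θ l' : ℕ) : ℝ) * V l' i j + V l i j := by
          rw [← sub_eq_iff_eq_add', ← Finset.sum_sub_distrib, Finset.sum_eq_single l]
          · rw [heq]
            push_cast
            ring
          · intro l' _ hl'
            rw [hne l' hl', sub_self]
          · simp
        rw [this]
        ring
      rw [add_sub_cancel, ← hs2, ← hI l]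
      congr 1
      simp only [hD, mul_pow, mul_div_assoc, ← Finset.mul_sum, mul_left_comm (c _)]
      push_cast
      ring)
    (fun x => ∑ i, ∑ j, (E x : Matrix (Fin k) (Fin k) ℝ) i j * V l i j)
    (∑ i, ∑ j, c j * V l i j) s
  refine le_trans (mul_le_mul_of_nonneg_left ?_ (Nat.cast_nonneg _)) (hvT.trans (le_of_eq ?_))
  · rw [div_le_iff₀ hn']
    refine (hL l).trans (le_of_eq ?_)
    rw [← hs2]
    ring
  · refine Finset.sum_congr rfl fun θ _ => Finset.sum_congr rfl fun x _ => ?_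
    have e1 : ∑ i, ∑ j, (s * ∑ l', ((θ l' : ℕ) : ℝ) * V l' i j) * V l i j =
        s * ((θ l : ℕ) : ℝ) := by
      calc _ = ∑ l', (s * ((θ l' : ℕ) : ℝ)) * ∑ i, ∑ j, V l' i j * V l i j := by
            simp only [Finset.mul_sum, Finset.sum_mul]
            rw [Finset.sum_comm' (t' := Finset.univ) (s' := fun _ => Finset.univ) (by simp)]
            rw [Finset.sum_congr rfl fun j _ => Finset.sum_comm]
            rw [Finset.sum_comm]
            refine Finset.sum_congr rfl fun l' _ => ?_
            rw [Finset.sum_comm]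
            exact Finset.sum_congr rfl fun i _ => Finset.sum_congr rfl fun j _ => by ring
        _ = _ := by simp [horth]
    have e2 : ∑ i, ∑ j, ((C θ).trans i j - (E x : Matrix (Fin k) (Fin k) ℝ) i j) * V l i j =
        (∑ i, ∑ j, c j * V l i j + s * ((θ l : ℕ) : ℝ)) -
          ∑ i, ∑ j, (E x : Matrix (Fin k) (Fin k) ℝ) i j * V l i j := by
      rw [← e1]
      simp only [hC, hM, ← Finset.sum_add_distrib, ← Finset.sum_sub_distrib]
      exact Finset.sum_congr rfl fun i _ => Finset.sum_congr rfl fun j _ => by ring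
    rw [e2]
    ring

/-! ### Lower bounds for the minimax risks. -/

/-- The maximum risk dominates the Bayes risk of the uniform prior on the finite family. -/
theorem le_minimaxWeightedRisk_of_average {k n : ℕ} {𝓜 : Set (MarkovChain k)} {Θ : Type*}
    [Fintype Θ] [Nonempty Θ] {C : Θ → MarkovChain k} (hC : ∀ θ, C θ ∈ 𝓜) {b : ℝ}
    (h : ∀ E : TransitionEstimator k n, Fintype.card Θ * b ≤ ∑ θ, weightedRisk (C θ) E) :
    b ≤ minimaxWeightedRisk 𝓜 n := by
  have : Nonempty (TransitionEstimator k n) := ⟨fun _ => 1⟩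
  refine le_ciInf fun E => ?_
  have hbdd : BddAbove (Set.range fun C : 𝓜 => weightedRisk C.1 E) :=
    ⟨2, by rintro _ ⟨C, rfl⟩; exact weightedRisk_le_two _ _⟩
  have h1 : ∑ θ, weightedRisk (C θ) E ≤ ∑ _θ : Θ, ⨆ C : 𝓜, weightedRisk C.1 E :=
    Finset.sum_le_sum fun θ _ => le_ciSup hbdd ⟨C θ, hC θ⟩
  rw [Finset.sum_const, Finset.card_univ, nsmul_eq_mul] at h1
  have hcard : (0 : ℝ) < Fintype.card Θ := by exact_mod_cast Fintype.card_pos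
  exact le_of_mul_le_mul_left ((h E).trans h1) hcard

theorem le_minimaxWorstStateRisk_of_average {k n : ℕ} {𝓜 : Set (MarkovChain k)} {Θ : Type*}
    [Fintype Θ] [Nonempty Θ] {C : Θ → MarkovChain k} (hC : ∀ θ, C θ ∈ 𝓜) {b : ℝ}
    (h : ∀ E : TransitionEstimator k n, Fintype.card Θ * b ≤ ∑ θ, worstStateRisk (C θ) E) :
    b ≤ minimaxWorstStateRisk 𝓜 n := by
  have : Nonempty (TransitionEstimator k n) := ⟨fun _ => 1⟩
  refine le_ciInf fun E => ?_
  have hbdd : BddAbove (Set.range fun C : 𝓜 => worstStateRisk C.1 E) :=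
    ⟨2, by rintro _ ⟨C, rfl⟩; exact worstStateRisk_le_two _ _⟩
  have h1 : ∑ θ, worstStateRisk (C θ) E ≤ ∑ _θ : Θ, ⨆ C : 𝓜, worstStateRisk C.1 E :=
    Finset.sum_le_sum fun θ _ => le_ciSup hbdd ⟨C θ, hC θ⟩
  rw [Finset.sum_const, Finset.card_univ, nsmul_eq_mul] at h1
  have hcard : (0 : ℝ) < Fintype.card Θ := by exact_mod_cast Fintype.card_pos
  exact le_of_mul_le_mul_left ((h E).trans h1) hcard

theorem MarkovChain.stat_eq_of_col_eq {k : ℕ} (C : MarkovChain k) {j : Fin k} {b : ℝ}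
    (h : ∀ i, C.trans i j = b) : C.stat j = b := by
  have e : C.stat j = ∑ i, C.stat i * C.trans i j := by
    conv_lhs => rw [← C.stat_vecMul]
    rfl
  rw [e]
  simp only [h, ← Finset.sum_mul, C.stat_mem.2, one_mul]

/-- The squared error at a state dominates its components along orthonormal directions. -/
theorem sum_sum_pathProb_mul_sq_le_stateRisk {k n : ℕ} {ι : Type*} [Fintype ι] [DecidableEq ι]
    {v : ι → Fin k → ℝ} (hv : ∀ l l', ∑ j, v l j * v l' j = if l = l' then 1 else 0)
    (C : MarkovChain k) (E : TransitionEstimator k n) (i : Fin k) :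
    ∑ l, ∑ x, C.pathProb n x *
        (∑ j, (C.trans i j - (E x : Matrix (Fin k) (Fin k) ℝ) i j) * v l j) ^ 2 ≤
      stateRisk C E i := by
  rw [Finset.sum_comm]
  refine Finset.sum_le_sum fun x _ => ?_
  rw [← Finset.mul_sum]
  exact mul_le_mul_of_nonneg_left (sum_sq_inner_le hv _) (pathProb_nonneg C n x)

/-- Lower bounds when the smallest stationary probability is below `1 / k`. -/
theorem eventually_le_minimax_of_lt {d : ℕ} {δ pmin : ℝ} (hp0 : 0 < pmin) (hδp : δ ≤ pmin)
    (hpk : pmin < 1 / ((d : ℝ) + 2)) : ∀ᶠ n : ℕ in atTop,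
      (1 - pmin) ^ 2 * (((d : ℝ) + 2) * d / (d + 1) / n) ≤
        minimaxWeightedRisk (MarkovChain.lowerBoundedStat (d + 2) δ pmin) n ∧
      (1 - pmin) ^ 2 * ((d : ℝ) / (d + 1) / (n * pmin)) ≤
        minimaxWorstStateRisk (MarkovChain.lowerBoundedStat (d + 2) δ pmin) n := by
  have hd : (0 : ℝ) < (d : ℝ) + 2 := by positivity
  have hd1 : (0 : ℝ) < (d : ℝ) + 1 := by positivity
  have hpk' : pmin * (d + 2) < 1 := by rwa [lt_div_iff₀ hd] at hpk
  have hp1 : pmin < 1 := by nlinarith [(Nat.cast_nonneg d : (0 : ℝ) ≤ d)]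
  set q : ℝ := (1 - pmin) / (d + 1) with hq
  have hqp : pmin < q := by
    rw [hq, lt_div_iff₀ hd1]
    linarith
  have hq0 : 0 < q := hp0.trans hqp
  set c : Fin (d + 2) → ℝ := fun j => if j = 0 then pmin else q with hcdef
  have hc0 : c 0 = pmin := by simp [hcdef]
  have hcne : ∀ j, j ≠ 0 → c j = q := fun j hj => by simp [hcdef, hj]
  have hcp : ∀ j, pmin ≤ c j := fun j => by
    by_cases hj : j = 0
    · rw [hj, hc0]
    · rw [hcne j hj]; exact hqp.le
  have hc : ∀ j, 0 < c j := fun j => hp0.trans_le (hcp j)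
  have hc1 : ∑ j, c j = 1 := by
    rw [Fin.sum_univ_succ, hc0]
    simp only [hcne _ (Fin.succ_ne_zero _), Finset.sum_const, Finset.card_univ, Fintype.card_fin,
      nsmul_eq_mul, hq]
    push_cast
    field_simp
    ring
  -- Orthogonality to the constants keeps row sums; orthogonality to the first basis vector freezes
  -- column 0, so that state 0 keeps stationary mass exactly `pmin`.
  obtain ⟨v, hv, hvw⟩ := exists_orthonormal_perp (d := d) (le_refl (d + 2))
    ![fun _ => 1, Pi.single 0 1]
  have hvsum : ∀ l, ∑ j, v l j = 0 := fun l => by simpa using hvw l 0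
  have hv0 : ∀ l, v l 0 = 0 := fun l => by simpa [Pi.single_apply] using hvw l 1
  set V : Fin (d + 2) × Fin d → Fin (d + 2) → Fin (d + 2) → ℝ :=
    fun l i j => if i = l.1 then v l.2 j else 0 with hV
  have hVe : ∀ (e : Fin (d + 2) → Fin (d + 2) → ℝ) (l : Fin (d + 2) × Fin d),
      ∑ i, ∑ j, e i j * V l i j = ∑ j, e l.1 j * v l.2 j := fun e l => by
    rw [Finset.sum_eq_single l.1]
    · simp [hV]
    · intro i _ hi
      simp [hV, hi]
    · simp
  -- Cramér-Rao with q = (1 - pmin)/(d + 1) accounts for one factor 1 - pmin of the claim. The other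
  -- is slack, split as τ·τ between the constant κ < 1/I and the comparison of stationary masses
  -- with `c`.
  set τ : ℝ := √(1 - pmin) with hτ
  have hτ0 : 0 < τ := Real.sqrt_pos.2 (by linarith)
  have hτ2 : τ ^ 2 = 1 - pmin := Real.sq_sqrt (by linarith)
  have hτ1 : τ < 1 := by nlinarith
  have hρ : 0 < min ((1 - τ) * pmin) (q - pmin) :=
    lt_min (mul_pos (by linarith) hp0) (by linarith)
  obtain ⟨L, hL⟩ := exists_perturbation_family (Nat.succ_pos (d + 1)) hc hc1 (V := V)
    -- The directions vanish at 0, where `c` differs from `q`, so the information in row `i` is c_i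
    -- / q.
    (I := fun l => c l.1 / q) (κ := fun l => τ * q / c l.1)
    (fun l i => by
      by_cases hi : i = l.1 <;> simp [hV, hi, hvsum])
    (fun l l' => by
      rw [hVe (fun i j => V l i j) l']
      by_cases h1 : l'.1 = l.1
      · simp only [hV, h1, if_true, hv, Prod.ext_iff, true_and]
      · have : l ≠ l' := fun h => h1 (by rw [h])
        simp [hV, h1, this])
    (fun l => by
      have e : ∀ j, v l.2 j ^ 2 / c j = v l.2 j * v l.2 j / q := fun j => by
        by_cases hj : j = 0
        · rw [hj, hv0]; simp
        · rw [hcne j hj, sq]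
      rw [Finset.sum_eq_single l.1]
      · simp only [hV, if_true, e, ← Finset.sum_div, hv]
        ring
      · intro i _ hi
        simp [hV, hi]
      · simp)
    (fun l => div_pos (hc _) hq0) (fun l => div_pos (mul_pos hτ0 hq0) (hc _))
    (fun l => by
      have := (hc l.1).ne'
      have e : τ * q / c l.1 * (c l.1 / q) = τ := by field_simp
      simpa only [e] using hτ1) hρ
  filter_upwards [hL, eventually_gt_atTop 0] with n hn hn0
  have hn' : (0 : ℝ) < n := by exact_mod_cast hn0
  obtain ⟨C, ⟨s, hCs⟩, hCρ, hCE⟩ := hn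
  have hcol : ∀ θ i, (C θ).trans i 0 = pmin := fun θ i => by
    rw [hCs, hc0]
    have : ∀ l, V l i 0 = 0 := fun l => by simp [hV, hv0]
    simp [this]
  have hent : ∀ θ i j, pmin ≤ (C θ).trans i j := fun θ i j => by
    by_cases hj : j = 0
    · rw [hj, hcol]
    · have h1 := (neg_le_of_abs_le (hCρ θ i j))
      have h2 := min_le_right ((1 - τ) * pmin) (q - pmin)
      rw [hcne j hj] at h1
      linarith
  have hmem : ∀ θ, C θ ∈ MarkovChain.lowerBoundedStat (d + 2) δ pmin := fun θ =>
    ⟨fun i j => hδp.trans (hent θ i j), ⟨0, (C θ).stat_eq_of_col_eq (hcol θ)⟩, by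
      rintro _ ⟨j, rfl⟩
      exact (C θ).le_stat fun i => hent θ i j⟩
  have hstat : ∀ θ i, τ * c i ≤ (C θ).stat i := fun θ j => (C θ).le_stat fun i => by
    have h1 := (neg_le_of_abs_le (hCρ θ i j))
    have h2 := min_le_left ((1 - τ) * pmin) (q - pmin)
    have h3 := mul_le_mul_of_nonneg_left (hcp j) (by linarith : 0 ≤ 1 - τ)
    linarith
  set N : ℝ := (Fintype.card (Fin (d + 2) × Fin d → Fin (L + 1)) : ℝ) with hN
  have hstate : ∀ E : TransitionEstimator (d + 2) n, ∀ i,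
      N * (d * (τ * q / c i / n)) ≤ ∑ θ, stateRisk (C θ) E i := fun E i => by
    have h1 : ∑ θ, ∑ l, ∑ x, (C θ).pathProb n x * (∑ j, ((C θ).trans i j -
        (E x : Matrix (Fin (d + 2)) (Fin (d + 2)) ℝ) i j) * v l j) ^ 2 ≤
          ∑ θ, stateRisk (C θ) E i :=
      Finset.sum_le_sum fun θ _ => sum_sum_pathProb_mul_sq_le_stateRisk hv (C θ) E i
    refine le_trans ?_ h1
    rw [Finset.sum_comm]
    have h2 : ∑ _l : Fin d, N * (τ * q / c i / n) = N * (d * (τ * q / c i / n)) := by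
      rw [Finset.sum_const, Finset.card_univ, Fintype.card_fin, nsmul_eq_mul]
      ring
    rw [← h2]
    refine Finset.sum_le_sum fun l _ => ?_
    have h3 := hCE E (i, l)
    simp only [hVe (fun a b => (C _).trans a b -
      (E _ : Matrix (Fin (d + 2)) (Fin (d + 2)) ℝ) a b)] at h3
    exact h3
  constructor
  · refine le_minimaxWeightedRisk_of_average hmem fun E => ?_
    rw [← hN]
    calc N * ((1 - pmin) ^ 2 * (((d : ℝ) + 2) * d / (d + 1) / n))
        = ∑ i, (τ * c i) * (N * (d * (τ * q / c i / n))) := by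
          have e : ∀ i, (τ * c i) * (N * (d * (τ * q / c i / n))) =
              N * (τ ^ 2 * q * d / n) := fun i => by
            have := (hc i).ne'
            field_simp
          simp only [e, Finset.sum_const, Finset.card_univ, Fintype.card_fin, nsmul_eq_mul]
          rw [hτ2, hq]
          push_cast
          field_simp
      _ ≤ ∑ i, (τ * c i) * ∑ θ, stateRisk (C θ) E i :=
          Finset.sum_le_sum fun i _ => mul_le_mul_of_nonneg_left (hstate E i)
            (mul_pos hτ0 (hc i)).le
      _ = ∑ θ, ∑ i, (τ * c i) * stateRisk (C θ) E i := by
          simp only [Finset.mul_sum]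
          exact Finset.sum_comm
      _ ≤ ∑ θ, weightedRisk (C θ) E := Finset.sum_le_sum fun θ _ => Finset.sum_le_sum fun i _ =>
          mul_le_mul_of_nonneg_right (hstat θ i) (stateRisk_nonneg _ _ _)
  · refine le_minimaxWorstStateRisk_of_average hmem fun E => ?_
    rw [← hN]
    -- State 0 has the least stationary mass, which makes its row the hardest to estimate.
    have h1 := hstate E 0
    rw [hc0] at h1
    refine le_trans ?_ (h1.trans (Finset.sum_le_sum fun θ _ => stateRisk_le_worstStateRisk _ _ 0))
    refine mul_le_mul_of_nonneg_left ?_ (Nat.cast_nonneg _)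
    have e1 : (1 - pmin) ^ 2 * ((d : ℝ) / (d + 1) / (n * pmin)) =
        (d / (d + 1) / (n * pmin) * (1 - pmin)) * τ ^ 2 := by rw [hτ2]; ring
    have e2 : d * (τ * q / pmin / n) = (d / (d + 1) / (n * pmin) * (1 - pmin)) * τ := by
      rw [hq]; field_simp
    rw [e1, e2]
    refine mul_le_mul_of_nonneg_left (by nlinarith) ?_
    have : 0 < 1 - pmin := by linarith
    positivity

/-- Lower bounds when the stationary distribution is uniform. -/
theorem eventually_le_minimax_of_uniform {d : ℕ} {δ : ℝ} (hδ : 0 < δ)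
    (hδk : δ < 1 / ((d : ℝ) + 2)) : ∀ᶠ n : ℕ in atTop,
      ((d : ℝ) + 1) * d / (d + 2) / n ≤
        minimaxWeightedRisk (MarkovChain.lowerBoundedStat (d + 2) δ (1 / ((d : ℝ) + 2))) n ∧
      ((d : ℝ) + 1) * d / (d + 2) / n ≤
        minimaxWorstStateRisk (MarkovChain.lowerBoundedStat (d + 2) δ (1 / ((d : ℝ) + 2))) n := by
  have hd : (0 : ℝ) < (d : ℝ) + 2 := by positivity
  have hd1 : (0 : ℝ) < (d : ℝ) + 1 := by positivity
  set c : ℝ := 1 / ((d : ℝ) + 2) with hcdef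
  have hc : 0 < c := by positivity
  have hc1 : ∑ _j : Fin (d + 2), c = 1 := by
    simp only [Finset.sum_const, Finset.card_univ, Fintype.card_fin, nsmul_eq_mul, hcdef]
    push_cast
    field_simp
  obtain ⟨v, hv, hvw⟩ := exists_orthonormal_perp (d := d + 1) (le_refl (d + 2)) ![fun _ => 1]
  have hvsum : ∀ l, ∑ j, v l j = 0 := fun l => by simpa using hvw l 0
  -- Products of mean-zero vectors have zero row and column sums, so every perturbed matrix is
  -- doubly stochastic and its stationary law stays uniform.
  set V : Fin (d + 1) × Fin (d + 1) → Fin (d + 2) → Fin (d + 2) → ℝ :=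
    fun l i j => v l.1 i * v l.2 j with hV
  have horth : ∀ l l', ∑ i, ∑ j, V l i j * V l' i j = if l = l' then 1 else 0 := fun l l' => by
    have e : ∀ i j, V l i j * V l' i j = (v l.1 i * v l'.1 i) * (v l.2 j * v l'.2 j) :=
      fun i j => by simp only [hV]; ring
    simp only [e, ← Finset.sum_mul_sum, hv, Prod.ext_iff]
    split_ifs <;> simp_all
  -- Any positive value in [d/(d + 1), 1) would do: there are (d + 1)² directions, while the claim
  -- needs only d(d + 1).
  set κ : ℝ := ((d : ℝ) + 1 / 2) / (d + 1) with hκ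
  have hκ0 : 0 < κ := by positivity
  have hκ1 : κ < 1 := by
    rw [hκ, div_lt_one hd1]
    linarith
  obtain ⟨L, hL⟩ := exists_perturbation_family (Nat.succ_pos (d + 1)) (fun _ => hc) hc1 (V := V)
    (I := fun _ => 1) (κ := fun _ => κ)
    (fun l i => by simp only [hV, ← Finset.mul_sum, hvsum, mul_zero]) horth
    (fun l => by
      have h := horth l l
      rw [if_pos rfl] at h
      rw [← h]
      refine Finset.sum_congr rfl fun i _ => ?_
      rw [Finset.mul_sum]
      refine Finset.sum_congr rfl fun j _ => ?_
      field_simp)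
    (fun _ => one_pos) (fun _ => hκ0) (fun _ => by simpa using hκ1)
    (sub_pos.2 hδk)
  filter_upwards [hL, eventually_gt_atTop 0] with n hn hn0
  have hn' : (0 : ℝ) < n := by exact_mod_cast hn0
  obtain ⟨C, ⟨s, hCs⟩, hCρ, hCE⟩ := hn
  have hent : ∀ θ i j, δ ≤ (C θ).trans i j := fun θ i j => by
    have h1 := (neg_le_of_abs_le (hCρ θ i j))
    linarith
  have hstat : ∀ θ i, (C θ).stat i = c := fun θ i => by
    have h := stationary_unique (C θ).trans_mem hδ (hent θ) (C θ).stat_mem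
      (q := fun _ => c) ⟨fun _ => hc.le, hc1⟩ (C θ).stat_vecMul (by
        funext j
        simp only [Matrix.vecMul, dotProduct, ← Finset.mul_sum, hCs, Finset.sum_add_distrib, hc1]
        rw [Finset.sum_comm]
        simp only [← Finset.mul_sum, hV, ← Finset.sum_mul, hvsum, zero_mul, mul_zero,
          Finset.sum_const_zero, add_zero, mul_one])
    exact congrFun h i
  have hmem : ∀ θ, C θ ∈ MarkovChain.lowerBoundedStat (d + 2) δ c := fun θ =>
    ⟨hent θ, ⟨0, hstat θ 0⟩, by rintro _ ⟨j, rfl⟩; exact (hstat θ j).ge⟩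
  have hsum : ∀ E : TransitionEstimator (d + 2) n,
      (Fintype.card (Fin (d + 1) × Fin (d + 1) → Fin (L + 1)) : ℝ) *
        (((d : ℝ) + 1) * d / (d + 2) / n) ≤ ∑ θ, weightedRisk (C θ) E := fun E => by
    have h1 : ∀ θ, c * ∑ l, ∑ x, (C θ).pathProb n x * (∑ i, ∑ j, ((C θ).trans i j -
        (E x : Matrix (Fin (d + 2)) (Fin (d + 2)) ℝ) i j) * V l i j) ^ 2 ≤
          weightedRisk (C θ) E := fun θ => by
      unfold weightedRisk stateRisk
      simp only [hstat, ← Finset.mul_sum]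
      refine mul_le_mul_of_nonneg_left ?_ hc.le
      rw [Finset.sum_comm]
      conv_rhs => rw [Finset.sum_comm]
      refine Finset.sum_le_sum fun x _ => ?_
      simp only [← Finset.mul_sum]
      refine mul_le_mul_of_nonneg_left ?_ (pathProb_nonneg _ n x)
      have h := sum_sq_inner_le (J := Fin (d + 2) × Fin (d + 2)) (V := fun l q => V l q.1 q.2)
        (fun l l' => by rw [Fintype.sum_prod_type]; exact horth l l')
        (fun q => (C θ).trans q.1 q.2 - (E x : Matrix (Fin (d + 2)) (Fin (d + 2)) ℝ) q.1 q.2)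
      simpa only [Fintype.sum_prod_type, l2Loss] using h
    refine le_trans ?_ (Finset.sum_le_sum fun θ _ => h1 θ)
    rw [← Finset.mul_sum, Finset.sum_comm]
    have h2 := Finset.sum_le_sum fun l (_ : l ∈ Finset.univ) => hCE E l
    refine le_trans ?_ (mul_le_mul_of_nonneg_left h2 hc.le)
    rw [Finset.sum_const, Finset.card_univ, nsmul_eq_mul]
    have e : c * ((Fintype.card (Fin (d + 1) × Fin (d + 1)) : ℝ) *
        ((Fintype.card (Fin (d + 1) × Fin (d + 1) → Fin (L + 1)) : ℝ) * (κ / n))) =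
        (Fintype.card (Fin (d + 1) × Fin (d + 1) → Fin (L + 1)) : ℝ) *
          (((d : ℝ) + 1) * (d + 1 / 2) / (d + 2) / n) := by
      rw [Fintype.card_prod, Fintype.card_fin, hκ, hcdef]
      push_cast
      field_simp
    rw [e]
    gcongr
    linarith
  exact ⟨le_minimaxWeightedRisk_of_average hmem hsum,
    le_minimaxWorstStateRisk_of_average hmem fun E => (hsum E).trans
      (Finset.sum_le_sum fun θ _ => weightedRisk_le_worstStateRisk _ _)⟩

/-! ### The theorem. -/

theorem asympLE_of_eventually_le {a b : ℕ → ℝ} (h : ∀ᶠ n in atTop, a n ≤ b n) : AsympLE a b :=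
  ⟨fun _ => 0, tendsto_const_nhds, by simpa using h⟩

theorem theorem5 (k : ℕ) (hk : 2 ≤ k) (δ pmin : ℝ) (hδ0 : 0 < δ) (hδk : δ < 1 / (k : ℝ))
    (hδp : δ ≤ pmin) (hpk : pmin ≤ 1 / (k : ℝ)) :
    (AsympLE (fun n => (1 - pmin) ^ 2 * (((k : ℝ) - (k : ℝ) / ((k : ℝ) - 1)) / (n : ℝ)))
        (minimaxWeightedRisk (MarkovChain.lowerBoundedStat k δ pmin)) ∧
      AsympLE (minimaxWeightedRisk (MarkovChain.lowerBoundedStat k δ pmin))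
        (fun n => ((k : ℝ) - 1) / (n : ℝ))) ∧
    (AsympLE (fun n => (1 - pmin) ^ 2 * ((1 - 1 / ((k : ℝ) - 1)) / ((n : ℝ) * pmin)))
        (minimaxWorstStateRisk (MarkovChain.lowerBoundedStat k δ pmin)) ∧
      AsympLE (minimaxWorstStateRisk (MarkovChain.lowerBoundedStat k δ pmin))
        (fun n => (1 - 1 / (k : ℝ)) / ((n : ℝ) * pmin))) := by
  have hp0 : 0 < pmin := hδ0.trans_le hδp
  suffices h : ∀ᶠ n : ℕ in atTop,
      (1 - pmin) ^ 2 * (((k : ℝ) - (k : ℝ) / ((k : ℝ) - 1)) / (n : ℝ)) ≤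
        minimaxWeightedRisk (MarkovChain.lowerBoundedStat k δ pmin) n ∧
      (1 - pmin) ^ 2 * ((1 - 1 / ((k : ℝ) - 1)) / ((n : ℝ) * pmin)) ≤
        minimaxWorstStateRisk (MarkovChain.lowerBoundedStat k δ pmin) n from
    ⟨⟨asympLE_of_eventually_le (h.mono fun _ h => h.1), minimaxWeightedRisk_asympLE hk hδ0⟩,
      asympLE_of_eventually_le (h.mono fun _ h => h.2), minimaxWorstStateRisk_asympLE hk hδ0 hp0⟩
  obtain ⟨d, rfl⟩ : ∃ d, k = d + 2 := ⟨k - 2, by omega⟩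
  have hcast : ((d + 2 : ℕ) : ℝ) = d + 2 := by push_cast; ring
  rw [hcast] at hδk hpk ⊢
  have hd : (0 : ℝ) < (d : ℝ) + 2 := by positivity
  have hd1 : (0 : ℝ) < (d : ℝ) + 1 := by positivity
  have e0 : (d : ℝ) + 2 - 1 = d + 1 := by ring
  have e1 : (d : ℝ) + 2 - (d + 2) / (d + 1) = (d + 2) * d / (d + 1) := by field_simp; ring
  have e2 : 1 - 1 / ((d : ℝ) + 1) = d / (d + 1) := by field_simp; ring
  rw [e0, e1, e2]
  rcases hpk.lt_or_eq with hlt | rfl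
  · exact eventually_le_minimax_of_lt hp0 hδp hlt
  · filter_upwards [eventually_le_minimax_of_uniform hδ0 hδk, eventually_gt_atTop 0] with n hn hn0
    have hn' : (0 : ℝ) < n := by exact_mod_cast hn0
    -- When pmin = 1/k the weighted and the worst-state lower bounds are the same number.
    have e3 : (1 - 1 / ((d : ℝ) + 2)) ^ 2 * ((d + 2) * d / (d + 1) / n) =
        ((d : ℝ) + 1) * d / (d + 2) / n := by
      rw [show 1 - 1 / ((d : ℝ) + 2) = (d + 1) / (d + 2) by field_simp; ring]
      field_simp
    have e4 : (1 - 1 / ((d : ℝ) + 2)) ^ 2 * (d / (d + 1) / (n * (1 / ((d : ℝ) + 2)))) =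
        ((d : ℝ) + 1) * d / (d + 2) / n := by
      rw [show 1 - 1 / ((d : ℝ) + 2) = (d + 1) / (d + 2) by field_simp; ring]
      field_simp
    rw [e3, e4]
    exact hn
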